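/- **Theorem (Generalization error bound for FastRNN).** Let $\sigma:\mathbb R\to\mathbb R$ be $1$-Lipschitz (for instance $\tanh$, the logistic sigmoid or ReLU). There are real constants $c_m$ $(m\in\mathbb N)$, depending only on $\sigma$ and on $m$, and not depending on $m$ if $\sigma'$ has bounded variation (as for $\tanh$, sigmoid and ReLU), such that the following holds. Let $d,m,T,n$ be natural numbers with $n\ge 1$, let $0\le\alpha\le 1$ and $\beta=1-\alpha$, and let $R_W,R_U,R_x,R_v,B\ge 0$. For $W\in\mathbb R^{m\times d}$, $U\in\mathbb R^{m\times m}$ and an input $X=(x_1,\dots,x_T)\in(\mathbb R^d)^T$ let $$h_0=0,\qquad h_t=\alpha\,\sigma(Wx_t+Uh_{t-1})+\beta\,h_{t-1}\quad(1\le t\le T),$$ with $\sigma$ applied coordinatewise. Let $\tau:\mathbb R\to\mathbb R$ be $1$-Lipschitz (for instance $\tau=\sigma$). Consider the classifiers $f(X)=\tau(v^\top h_T)$ with $\|W\|_F\le R_W$, $\|U\|_F\le R_U$, $\|v\|_2\le R_v$. Let $\mathcal Y,\hat{\mathcal Y}\subseteq\mathbb R$ (for instance subsets of $[0,1]$) be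 such that all these $f$ take values in $\hat{\mathcal Y}$ on inputs with $\|x_t\|_2\le R_x$ for all $t$, and let $L:\mathcal Y\times\hat{\mathcal Y}\to[0,B]$ be $1$-Lipschitz in each argument. Let $P$ be a probability distribution of pairs $(X,y)$ such that almost surely $y\in\mathcal Y$ and $\|x_t\|_2\le R_x$ for all $t$; let $(X_1,y_1),\dots,(X_n,y_n)$ be independent samples from $P$, and let $0<\delta\le1$. Let $\mathcal D=\sup\|\mathrm{diag}(\sigma'(Wx_t+Uh_{t-1}))\|_2$, the supremum over all $1\le t\le T$, all $W,U$ with $\|W\|_F\le R_W$, $\|U\|_F\le R_U$ and all inputs with $\|x_s\|_2\le R_x$ for all $s$ (with $\sigma'$ read as $0$ where $\sigma$ is not differentiable). Then, with probability at least $1-\delta$, every such $f$ whose matrix $U$ satisfies $$\alpha\le\min\left(\frac1{4T\,\bigl|\mathcal D\|U\|_2-1\bigr|},\ \frac1{4T R_U},\ \frac1{T\,\bigl|\|U\|_2-1\bigr|}\right)\qquad(\text{with } 1/0=\infty)$$ has $$\mathbb E_P\,L(y,f(X))\ \le\ \frac1n\sum_{i=1}^nL(y_i,f(X_i))+\mathcal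 C\,\frac{c_m\,\alpha T}{\sqrt n}+B\sqrt{\frac{\ln(1/\delta)}{n}},\qquad \mathcal C=\bigl(R_WR_x+\sqrt m\,|\sigma(0)|\bigr)\max(1,R_U)\,R_v .$$ If $\sigma(0)=0$ (e.g. $\tanh$, ReLU) and $R_U\ge1$, then $\mathcal C=R_WR_UR_xR_v$. In particular, for $\alpha=O(1/T)$ the bound does not depend on $T$. -/

import Mathlib

open MeasureTheory

noncomputable section

namespace FastRNN

/-- The Frobenius norm of a real matrix. -/
def frobNorm {p q : ℕ} (A : Matrix (Fin p) (Fin q) ℝ) : ℝ :=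
  √(∑ i, ∑ j, A i j ^ 2)

/-- The spectral norm of a square real matrix: its operator norm on Euclidean space. -/
def specNorm {p : ℕ} (A : Matrix (Fin p) (Fin p) ℝ) : ℝ :=
  ‖Matrix.toEuclideanCLM (𝕜 := ℝ) A‖

/-- The argument `W x + U h` of the nonlinearity in one step. -/
def preact {d m : ℕ} (W : Matrix (Fin m) (Fin d) ℝ) (U : Matrix (Fin m) (Fin m) ℝ)
    (x : EuclideanSpace ℝ (Fin d)) (h : EuclideanSpace ℝ (Fin m)) : Fin m → ℝ :=
  fun i => W.mulVec x.ofLp i + U.mulVec h.ofLp i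

/-- One update `h ↦ α σ(W x + U h) + β h`, with `σ` applied in each coordinate. -/
def step (σ : ℝ → ℝ) (α β : ℝ) {d m : ℕ}
    (W : Matrix (Fin m) (Fin d) ℝ) (U : Matrix (Fin m) (Fin m) ℝ)
    (x : EuclideanSpace ℝ (Fin d)) (h : EuclideanSpace ℝ (Fin m)) : EuclideanSpace ℝ (Fin m) :=
  α • WithLp.toLp 2 (fun i => σ (preact W U x h i)) + β • h

/-- The hidden state after reading all of `x₁, …, x_k` in this order, started at `h₀ = 0`. -/
def hidden (σ : ℝ → ℝ) (α β : ℝ) {d m : ℕ}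
    (W : Matrix (Fin m) (Fin d) ℝ) (U : Matrix (Fin m) (Fin m) ℝ) :
    (k : ℕ) → (Fin k → EuclideanSpace ℝ (Fin d)) → EuclideanSpace ℝ (Fin m)
  | 0, _ => 0
  | k + 1, X => step σ α β W U (X (Fin.last k)) (hidden σ α β W U k (fun t => X t.castSucc))

/-- The classifier `X ↦ τ(vᵀ h_T)`. -/
def classifier (σ τ : ℝ → ℝ) (α β : ℝ) {d m T : ℕ}
    (W : Matrix (Fin m) (Fin d) ℝ) (U : Matrix (Fin m) (Fin m) ℝ)
    (v : EuclideanSpace ℝ (Fin m)) (X : Fin T → EuclideanSpace ℝ (Fin d)) : ℝ :=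
  τ (inner ℝ v (hidden σ α β W U T X))

/-- The Jacobian `diag(σ'(W x_{k+1} + U h_k))` of the nonlinearity at the last step of the input
`x₁, …, x_{k+1}`. -/
def jacobian (σ : ℝ → ℝ) (α β : ℝ) {d m : ℕ}
    (W : Matrix (Fin m) (Fin d) ℝ) (U : Matrix (Fin m) (Fin m) ℝ)
    {k : ℕ} (X : Fin (k + 1) → EuclideanSpace ℝ (Fin d)) : Matrix (Fin m) (Fin m) ℝ :=
  Matrix.diagonal fun i =>
    deriv σ (preact W U (X (Fin.last k)) (hidden σ α β W U k (fun t => X t.castSucc)) i)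

/-- The supremum of the spectral norms of the Jacobians of the nonlinearity, over all steps
`1, …, T`, all weights with `‖W‖_F ≤ RW` and `‖U‖_F ≤ RU`, and all inputs bounded by `Rx`. -/
def jacobianSup (σ : ℝ → ℝ) (α β : ℝ) (d m T : ℕ) (RW RU Rx : ℝ) : ℝ :=
  sSup {r : ℝ | ∃ k < T, ∃ (W : Matrix (Fin m) (Fin d) ℝ) (U : Matrix (Fin m) (Fin m) ℝ)
    (X : Fin (k + 1) → EuclideanSpace ℝ (Fin d)),
    frobNorm W ≤ RW ∧ frobNorm U ≤ RU ∧ (∀ t, ‖X t‖ ≤ Rx) ∧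
    r = specNorm (jacobian σ α β W U X)}

/-- The condition `α ≤ min (1 / (4 T |𝒟 ‖U‖₂ - 1|), 1 / (4 T RU), 1 / (T |‖U‖₂ - 1|))`, with a
quotient by zero read as `+∞`. -/
def AlphaCondition (α : ℝ) {m : ℕ} (T : ℕ) (𝒟 RU : ℝ) (U : Matrix (Fin m) (Fin m) ℝ) : Prop :=
  α * (4 * T * |𝒟 * specNorm U - 1|) ≤ 1 ∧
  α * (4 * T * RU) ≤ 1 ∧
  α * (T * |specNorm U - 1|) ≤ 1

/-- Expected loss of `f` under the distribution `P` of a pair (input, label). -/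
def expectedLoss {𝓧 : Type*} [MeasurableSpace 𝓧] (P : Measure (𝓧 × ℝ)) (L : ℝ → ℝ → ℝ)
    (f : 𝓧 → ℝ) : ℝ :=
  ∫ p, L p.2 (f p.1) ∂P

/-- Average loss of `f` on the sample `S`. -/
def empiricalLoss {𝓧 : Type*} {n : ℕ} (S : Fin n → 𝓧 × ℝ) (L : ℝ → ℝ → ℝ) (f : 𝓧 → ℝ) : ℝ :=
  (1 / n) * ∑ i, L (S i).2 (f (S i).1)

end FastRNN

end

/-! The gap between expected and empirical loss is governed by Rademacher complexity: McDiarmid's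
inequality concentrates the largest gap, symmetrization bounds its mean by twice the complexity
(`integral_maxGap_le`), and the contraction principle `rad_le_rad` strips off the loss and `τ`. What
remains is A_T, the average over signs of sup ‖∑ ε_k h_T(X_k)‖.

One layer increases complexities by at most a constant κ (`IsLayerConst`) and enters the recursion
with weight α. With D = R_W R_x + √m |σ(0)| this gives A_{T+1} ≤ (1 + ακR_U) A_T + 2καD√n. Since αT
R_U ≤ 1/4, the factors (1 + ακR_U) multiply to at most exp(κ/4), and A_T is linear in αT
(`signAvg_iSup_hidden_le`).

For a general Lipschitz σ, treating the m neurons separately costs κ of order √m. If σ' has bounded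
variation, σ − σ(0) is a superposition of ramps of finite total weight. The family of ramps is
positively homogeneous, so the sizes of the rows of W and U can be pulled out; the Frobenius norm
bounds the sum of their squares, and κ does not depend on m (`isLayerConst_of_ramp_bound`).

Everything is done for finite classes. Losses depend continuously on parameters in a separable
space, so the general case follows by exhaustion along a dense sequence. -/

namespace FastRNN

/-! ### Sign averages and signed sums. -/

/-- The average of `F` over all vectors of `n` signs. -/
noncomputable def signAvg {n : ℕ} (F : (Fin n → ℤˣ) → ℝ) : ℝ :=
  (∑ ε, F ε) / Fintype.card (Fin n → ℤˣ)

/-- The signed sum `∑ₖ εₖ aₖ`. -/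
def signSum {n : ℕ} {E : Type*} [AddCommGroup E] [Module ℝ E] (ε : Fin n → ℤˣ)
    (a : Fin n → E) : E :=
  ∑ k, (((ε k : ℤˣ) : ℤ) : ℝ) • a k

/-- The (unnormalized) Rademacher complexity of a family of vectors. -/
noncomputable def rad {n : ℕ} {ι : Type*} (a : ι → Fin n → ℝ) : ℝ :=
  signAvg fun ε => ⨆ i, signSum ε (a i)

section signAvg
variable {n : ℕ} {F G : (Fin n → ℤˣ) → ℝ}

theorem signAvg_mono (h : ∀ ε, F ε ≤ G ε) : signAvg F ≤ signAvg G := by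
  unfold signAvg
  gcongr with ε
  exact h ε

theorem signAvg_add (F G : (Fin n → ℤˣ) → ℝ) :
    signAvg (fun ε => F ε + G ε) = signAvg F + signAvg G := by
  simp only [signAvg, Finset.sum_add_distrib, add_div]

theorem signAvg_const_mul (c : ℝ) (F : (Fin n → ℤˣ) → ℝ) :
    signAvg (fun ε => c * F ε) = c * signAvg F := by
  simp only [signAvg, ← Finset.mul_sum, mul_div_assoc]

theorem signAvg_const (c : ℝ) : signAvg (fun _ : Fin n → ℤˣ => c) = c := by
  simp [signAvg]

theorem signAvg_nonneg (h : ∀ ε, 0 ≤ F ε) : 0 ≤ signAvg F :=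
  (signAvg_const (n := n) 0).symm.le.trans (signAvg_mono h)

theorem signAvg_mul_right (η : Fin n → ℤˣ) (F : (Fin n → ℤˣ) → ℝ) :
    signAvg (fun ε => F (ε * η)) = signAvg F := by
  unfold signAvg
  congr 1
  exact Equiv.sum_comp (Equiv.mulRight η) F

theorem signAvg_neg (F : (Fin n → ℤˣ) → ℝ) : signAvg (fun ε => F (-ε)) = signAvg F := by
  simpa using signAvg_mul_right (-1) F

/-- Multiplication by `η` permutes the sign vectors, so it suffices to compare sums over the pairs
{ε, εη}. It is applied with an `η` that flips a single sign. -/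
theorem signAvg_le_of_add_le (η : Fin n → ℤˣ)
    (h : ∀ ε, F ε + F (ε * η) ≤ G ε + G (ε * η)) : signAvg F ≤ signAvg G := by
  have h1 := signAvg_mono h
  rw [signAvg_add F, signAvg_add G, signAvg_mul_right, signAvg_mul_right] at h1
  linarith

theorem signAvg_le_sqrt (F : (Fin n → ℤˣ) → ℝ) : signAvg F ≤ √(signAvg fun ε => F ε ^ 2) := by
  apply Real.le_sqrt_of_sq_le
  have hv : 0 ≤ signAvg fun ε => (F ε - signAvg F) ^ 2 := signAvg_nonneg fun ε => sq_nonneg _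
  have : (fun ε => (F ε - signAvg F) ^ 2) =
      fun ε => F ε ^ 2 + ((-2 * signAvg F) * F ε + signAvg F ^ 2) := by
    funext ε; ring
  rw [this, signAvg_add, signAvg_add (fun ε => (-2 * signAvg F) * F ε), signAvg_const_mul,
    signAvg_const] at hv
  nlinarith

end signAvg

theorem abs_sign (e : ℤˣ) : |((e : ℤ) : ℝ)| = 1 := by
  rcases Int.units_eq_one_or e with rfl | rfl <;> simp

section signSum
variable {n : ℕ} {E : Type*}

theorem signSum_neg [AddCommGroup E] [Module ℝ E] (ε : Fin n → ℤˣ) (a : Fin n → E) :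
    signSum (-ε) a = -signSum ε a := by
  simp [signSum]

theorem signSum_add [AddCommGroup E] [Module ℝ E] (ε : Fin n → ℤˣ) (a b : Fin n → E) :
    signSum ε (fun k => a k + b k) = signSum ε a + signSum ε b := by
  simp [signSum, Finset.sum_add_distrib]

theorem signSum_sub [AddCommGroup E] [Module ℝ E] (ε : Fin n → ℤˣ) (a b : Fin n → E) :
    signSum ε (fun k => a k - b k) = signSum ε a - signSum ε b := by
  simp [signSum, Finset.sum_sub_distrib, smul_sub]

theorem signSum_smul [AddCommGroup E] [Module ℝ E] (ε : Fin n → ℤˣ) (c : ℝ) (a : Fin n → E) :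
    signSum ε (fun k => c • a k) = c • signSum ε a := by
  simp only [signSum, Finset.smul_sum]
  exact Finset.sum_congr rfl fun k _ => smul_comm _ _ _

theorem signSum_zero [AddCommGroup E] [Module ℝ E] (ε : Fin n → ℤˣ) :
    signSum ε (fun _ => (0 : E)) = 0 := by
  simp [signSum]

theorem map_signSum {F' : Type*} [AddCommGroup E] [Module ℝ E] [AddCommGroup F'] [Module ℝ F']
    (φ : E →ₗ[ℝ] F') (ε : Fin n → ℤˣ) (a : Fin n → E) :
    φ (signSum ε a) = signSum ε fun k => φ (a k) := by
  simp [signSum]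

theorem inner_signSum [NormedAddCommGroup E] [InnerProductSpace ℝ E] (w : E)
    (ε : Fin n → ℤˣ) (a : Fin n → E) :
    inner ℝ w (signSum ε a) = signSum ε fun k => (inner ℝ w (a k) : ℝ) := by
  simp [signSum, inner_sum, inner_smul_right]

theorem norm_signSum_le [NormedAddCommGroup E] [NormedSpace ℝ E] {M : ℝ} (ε : Fin n → ℤˣ)
    {a : Fin n → E} (h : ∀ k, ‖a k‖ ≤ M) : ‖signSum ε a‖ ≤ n * M := by
  refine (norm_sum_le_of_le (f := fun k => (((ε k : ℤˣ) : ℤ) : ℝ) • a k) _ fun k _ => ?_).trans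
    (b := ∑ _k : Fin n, M) (by simp)
  rw [norm_smul, Real.norm_eq_abs, abs_sign, one_mul]
  exact h k

/-- Orthogonality of the signs: averaging over the sign of index `j`, the parallelogram law cancels
the cross term with the rest of the sum. -/
theorem signAvg_norm_sq_sum [NormedAddCommGroup E] [InnerProductSpace ℝ E] (a : Fin n → E)
    (s : Finset (Fin n)) :
    signAvg (fun ε => ‖∑ k ∈ s, (((ε k : ℤˣ) : ℤ) : ℝ) • a k‖ ^ 2) ≤ ∑ k ∈ s, ‖a k‖ ^ 2 := by
  induction s using Finset.induction_on with
  | empty => simp [signAvg]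
  | insert j s hj ih =>
    rw [Finset.sum_insert hj, ← signAvg_const (n := n) (‖a j‖ ^ 2)]
    refine le_trans ?_ (add_le_add_right ih _)
    rw [← signAvg_add (fun _ => ‖a j‖ ^ 2)]
    refine signAvg_le_of_add_le (Pi.mulSingle j (-1)) fun ε => ?_
    have hs : ∑ k ∈ s, ((((ε * Pi.mulSingle j (-1) : Fin n → ℤˣ) k : ℤˣ) : ℤ) : ℝ) • a k =
        ∑ k ∈ s, (((ε k : ℤˣ) : ℤ) : ℝ) • a k := by
      refine Finset.sum_congr rfl fun k hk => ?_
      have : k ≠ j := fun h => hj (h ▸ hk)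
      simp [Pi.mulSingle_eq_of_ne this]
    simp only [Finset.sum_insert hj, hs]
    set b := ∑ k ∈ s, (((ε k : ℤˣ) : ℤ) : ℝ) • a k
    have h1 := parallelogram_law_with_norm ℝ b ((((ε j : ℤˣ) : ℤ) : ℝ) • a j)
    have h2 : ‖(((ε j : ℤˣ) : ℤ) : ℝ) • a j‖ = ‖a j‖ := by
      rw [norm_smul, Real.norm_eq_abs, abs_sign, one_mul]
    rw [h2] at h1
    simp only [Pi.mul_apply, Pi.mulSingle_eq_same, mul_neg, mul_one, Units.val_neg, Int.cast_neg,
      neg_smul]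
    rw [add_comm _ b, add_comm _ b, ← sub_eq_add_neg]
    nlinarith

theorem signAvg_norm_signSum_le [NormedAddCommGroup E] [InnerProductSpace ℝ E] {R : ℝ}
    {a : Fin n → E} (h : ∀ k, ‖a k‖ ≤ R) (hR : 0 ≤ R) :
    signAvg (fun ε => ‖signSum ε a‖) ≤ √n * R := by
  refine (signAvg_le_sqrt _).trans ?_
  rw [Real.sqrt_le_left (by positivity), mul_pow, Real.sq_sqrt (by positivity)]
  refine (signAvg_norm_sq_sum a Finset.univ).trans ?_
  calc ∑ k, ‖a k‖ ^ 2 ≤ ∑ _k : Fin n, R ^ 2 := by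
        gcongr with k; exact h k
    _ = n * R ^ 2 := by simp

end signSum

/-! ### Rademacher complexity and contraction. -/

section rad
variable {n : ℕ} {ι : Type*} {a b : ι → Fin n → ℝ}

/-- A real supremum over an unbounded family has the default value 0; hence the uniform bounds `M`
carried through all complexity estimates. -/
theorem bddAbove_signSum {M : ℝ} (h : ∀ i k, |a i k| ≤ M) (ε : Fin n → ℤˣ) :
    BddAbove (Set.range fun i => signSum ε (a i)) := by
  refine ⟨n * M, ?_⟩
  rintro _ ⟨i, rfl⟩
  exact (le_abs_self (signSum ε (a i))).trans (norm_signSum_le (E := ℝ) ε (h i))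

theorem bddAbove_norm_signSum {E : Type*} [NormedAddCommGroup E] [NormedSpace ℝ E]
    {a : ι → Fin n → E} {M : ℝ} (h : ∀ i k, ‖a i k‖ ≤ M) (ε : Fin n → ℤˣ) :
    BddAbove (Set.range fun i => ‖signSum ε (a i)‖) :=
  ⟨n * M, by rintro _ ⟨i, rfl⟩; exact norm_signSum_le ε (h i)⟩

/-- Pair ε with its flip at `j`. The two suprema then combine to a supremum over pairs (i, i') in
which coordinate `j` enters only through ±(b i j − b i' j), which is dominated by |a i j − a i' j|.
-/
theorem rad_le_of_coordinate [Nonempty ι] {M : ℝ} (ha : ∀ i k, |a i k| ≤ M) (j : Fin n)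
    (hne : ∀ i k, k ≠ j → b i k = a i k) (hj : ∀ i i', |b i j - b i' j| ≤ |a i j - a i' j|) :
    rad b ≤ rad a := by
  have hsplit : ∀ (c : ι → Fin n → ℝ) (ε : Fin n → ℤˣ) (i : ι), signSum ε (c i) =
      ∑ k ∈ Finset.univ.erase j, (((ε k : ℤˣ) : ℤ) : ℝ) * c i k + (((ε j : ℤˣ) : ℤ) : ℝ) * c i j := by
    intro c ε i
    rw [Finset.sum_erase_add _ _ (Finset.mem_univ j)]; rfl
  refine signAvg_le_of_add_le (Pi.mulSingle j (-1)) fun ε => ?_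
  set e : ℝ := (((ε j : ℤˣ) : ℤ) : ℝ) with he
  set B : ι → ℝ := fun i => ∑ k ∈ Finset.univ.erase j, (((ε k : ℤˣ) : ℤ) : ℝ) * a i k with hB
  have ha1 : ∀ i, signSum ε (a i) = B i + e * a i j := hsplit a ε
  have hb1 : ∀ i, signSum ε (b i) = B i + e * b i j := fun i => by
    rw [hsplit b ε, hB, he]
    congr 1
    exact Finset.sum_congr rfl fun k hk => by rw [hne i k (Finset.ne_of_mem_erase hk)]
  have hflip : ∀ (c : ι → Fin n → ℝ) i, signSum (ε * Pi.mulSingle j (-1)) (c i) =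
      signSum ε (c i) - 2 * (e * c i j) := by
    intro c i
    rw [hsplit c, hsplit c]
    have : ∑ k ∈ Finset.univ.erase j,
        ((((ε * Pi.mulSingle j (-1) : Fin n → ℤˣ) k : ℤˣ) : ℤ) : ℝ) * c i k =
        ∑ k ∈ Finset.univ.erase j, (((ε k : ℤˣ) : ℤ) : ℝ) * c i k :=
      Finset.sum_congr rfl fun k hk => by
        simp [Pi.mulSingle_eq_of_ne (Finset.ne_of_mem_erase hk)]
    rw [this]
    simp only [Pi.mul_apply, Pi.mulSingle_eq_same, mul_neg, mul_one, Units.val_neg, Int.cast_neg]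
    rw [← he]; ring
  have hA := fun i => le_ciSup (bddAbove_signSum ha ε) i
  have hA' := fun i => le_ciSup (bddAbove_signSum ha (ε * Pi.mulSingle j (-1))) i
  set S := ⨆ i, signSum ε (a i)
  set S' := ⨆ i, signSum (ε * Pi.mulSingle j (-1)) (a i)
  -- The absolute value |a i j − a i' j| is attained either by (i, i') or, with the roles of the two
  -- sign vectors exchanged, by (i', i).
  have key : ∀ i i', signSum ε (b i) + signSum (ε * Pi.mulSingle j (-1)) (b i') ≤ S + S' := by
    intro i i'
    have h1 := hA i; have h2 := hA' i'; have h3 := hA i'; have h4 := hA' i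
    rw [ha1] at h1 h3
    rw [hflip, ha1] at h2 h4
    rw [hflip, hb1, hb1]
    have h5 : e * b i j - e * b i' j ≤ |a i j - a i' j| := by
      refine le_trans ?_ (hj i i')
      rw [← mul_sub]
      refine (le_abs_self _).trans ?_
      rw [abs_mul, he, abs_sign, one_mul]
    have h6 : |a i j - a i' j| = |e * a i j - e * a i' j| := by
      rw [← mul_sub, abs_mul, he, abs_sign, one_mul]
    rw [h6] at h5
    rcases abs_cases (e * a i j - e * a i' j) with ⟨h7, -⟩ | ⟨h7, -⟩ <;> rw [h7] at h5 <;> linarith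
  have h1 : ∀ i', (⨆ i, signSum ε (b i)) ≤
      S + S' - signSum (ε * Pi.mulSingle j (-1)) (b i') := fun i' =>
    ciSup_le fun i => by linarith [key i i']
  have h2 : (⨆ i, signSum (ε * Pi.mulSingle j (-1)) (b i)) ≤
      S + S' - ⨆ i, signSum ε (b i) := ciSup_le fun i' => by linarith [h1 i']
  linarith

/-- The contraction principle of Ledoux and Talagrand. -/
theorem rad_le_rad [Nonempty ι] {M : ℝ} (ha : ∀ i k, |a i k| ≤ M) (hb : ∀ i k, |b i k| ≤ M)
    (h : ∀ i i' k, |b i k - b i' k| ≤ |a i k - a i' k|) : rad b ≤ rad a := by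
  classical
  -- Coordinates are switched from `a` to `b` one at a time.
  have key : ∀ s : Finset (Fin n), rad (fun i k => if k ∈ s then b i k else a i k) ≤ rad a := by
    intro s
    induction s using Finset.induction_on with
    | empty => simp
    | insert j s hj ih =>
      refine le_trans (rad_le_of_coordinate (M := M) (fun i k => ?_) j (fun i k hk => ?_)
        fun i i' => ?_) ih
      · split_ifs; exacts [hb i k, ha i k]
      · simp [hk]
      · simpa [hj] using h i i' j
  simpa using key Finset.univ

/-- The zero member `i₀` makes both suprema, at ε and at −ε, nonnegative, so their sum dominates the
absolute value; both have the same average. -/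
theorem signAvg_iSup_abs_le [Nonempty ι] {M : ℝ} (ha : ∀ i k, |a i k| ≤ M) (i₀ : ι)
    (h₀ : ∀ k, a i₀ k = 0) :
    signAvg (fun ε => ⨆ i, |signSum ε (a i)|) ≤ 2 * rad a := by
  have h1 : ∀ ε : Fin n → ℤˣ, ∀ i, signSum ε (a i) ≤ ⨆ i, signSum ε (a i) :=
    fun ε i => le_ciSup (bddAbove_signSum ha ε) i
  have h0 : ∀ ε : Fin n → ℤˣ, 0 ≤ ⨆ i, signSum ε (a i) := fun ε => by
    simpa [signSum, h₀] using h1 ε i₀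
  calc signAvg (fun ε => ⨆ i, |signSum ε (a i)|)
      ≤ signAvg (fun ε => (⨆ i, signSum ε (a i)) + ⨆ i, signSum (-ε) (a i)) := by
        refine signAvg_mono fun ε => ciSup_le fun i => ?_
        have h2 := h1 (-ε) i
        rw [signSum_neg] at h2
        exact abs_le'.2 ⟨by linarith [h1 ε i, h0 (-ε)], by linarith [h0 ε]⟩
    _ = 2 * rad a := by
        rw [signAvg_add, signAvg_neg fun ε => ⨆ i, signSum ε (a i), two_mul]; rfl

end rad
-- Ramps, and functions with derivative of bounded variation.
/-- The shifted ramp with kink at `t`, normalized to vanish at `0`. -/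
def ramp (t z : ℝ) : ℝ := max (z - t) 0 - max (-t) 0

theorem ramp_zero (t : ℝ) : ramp t 0 = 0 := by simp [ramp]

/-- This homogeneity lets the norm of a row be scaled out of a neuron at the price of moving the
kink. -/
theorem ramp_mul {s : ℝ} (hs : 0 ≤ s) (t z : ℝ) : ramp (s * t) (s * z) = s * ramp t z := by
  simp only [ramp, ← mul_sub, mul_sub s (max _ _), mul_max_of_nonneg _ _ hs, mul_zero, mul_neg]

theorem ramp_of_le {t z : ℝ} (ht : t ≤ 0) (h : t ≤ z) : ramp t z = z := by
  rw [ramp, max_eq_left (by linarith), max_eq_left (by linarith)]; ring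

theorem ramp_of_ge {t z : ℝ} (ht : 0 ≤ t) (h : z ≤ t) : ramp t z = 0 := by
  rw [ramp, max_eq_right (by linarith), max_eq_right (by linarith)]; ring

theorem lipschitzWith_ramp (t : ℝ) : LipschitzWith 1 (ramp t) := by
  refine LipschitzWith.of_dist_le_mul fun x y => ?_
  simp only [ramp, Real.dist_eq, NNReal.coe_one, one_mul, sub_sub_sub_cancel_right]
  exact (abs_max_sub_max_le_abs _ _ _).trans (by simp)

/-- On [-M, M] a ramp with kink outside the interval is the identity or zero, so kinks in [-M, M]
suffice. -/
theorem ramp_projIcc {M t z : ℝ} (hz : |z| ≤ M) : ramp (max (-M) (min M t)) z = ramp t z := by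
  have hM : 0 ≤ M := (abs_nonneg _).trans hz
  obtain ⟨h1, h2⟩ := abs_le.1 hz
  rcases le_total t (-M) with h | h
  · rw [max_eq_left ((min_le_right _ _).trans h), ramp_of_le (by linarith) h1,
      ramp_of_le (by linarith) (by linarith)]
  · rcases le_total M t with h' | h'
    · rw [min_eq_left h', max_eq_right (by linarith), ramp_of_ge hM h2,
        ramp_of_ge (by linarith) (by linarith)]
    · rw [min_eq_right h', max_eq_right h]

theorem hasDerivAt_ramp_of_lt {t z : ℝ} (h : t < z) : HasDerivAt (ramp t) 1 z := by
  have : ramp t =ᶠ[nhds z] fun y => y - t - max (-t) 0 := by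
    filter_upwards [lt_mem_nhds h] with y hy
    rw [ramp, max_eq_left (by linarith)]
  exact (((hasDerivAt_id z).sub_const t).sub_const _).congr_of_eventuallyEq this

theorem hasDerivAt_ramp_of_gt {t z : ℝ} (h : z < t) : HasDerivAt (ramp t) 0 z := by
  have : ramp t =ᶠ[nhds z] fun y => 0 - max (-t) 0 := by
    filter_upwards [gt_mem_nhds h] with y hy
    rw [ramp, max_eq_right (by linarith)]
  exact (hasDerivAt_const z _).congr_of_eventuallyEq this

theorem integral_deriv_of_lipschitzWith {f : ℝ → ℝ} {K : NNReal} (hf : LipschitzWith K f) (a b : ℝ) :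
    ∫ x in a..b, deriv f x = f b - f a :=
  (LipschitzOnWith.absolutelyContinuousOnInterval
    (hf.lipschitzOnWith (s := Set.uIcc a b))).integral_deriv_eq_sub

/-- An upper set is a half-line up to its endpoint, and the indicator of a half-line is almost
everywhere the derivative of a ramp. -/
theorem integral_indicator_upperSet {S : Set ℝ} (hS : IsUpperSet S) (hne : S.Nonempty)
    (hb : BddBelow S) (z : ℝ) :
    ∫ y in (0 : ℝ)..z, S.indicator (fun _ => (1 : ℝ)) y = ramp (sInf S) z := by
  have h0 := integral_deriv_of_lipschitzWith (lipschitzWith_ramp (sInf S)) 0 z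
  rw [ramp_zero, sub_zero] at h0
  rw [← h0]
  refine intervalIntegral.integral_congr_ae ?_
  filter_upwards [compl_mem_ae_iff.2 (measure_singleton (μ := volume) (sInf S))] with y hy _
  rcases lt_or_gt_of_ne (show y ≠ sInf S from hy) with h | h
  · rw [(hasDerivAt_ramp_of_gt h).deriv, Set.indicator_of_notMem]
    exact fun hyS => absurd (csInf_le hb hyS) (not_le.2 h)
  · obtain ⟨x, hx, hxy⟩ := exists_lt_of_csInf_lt hne h
    rw [(hasDerivAt_ramp_of_lt h).deriv, Set.indicator_of_mem (hS hxy.le hx)]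

section
variable {n : ℕ} {ε : Fin n → ℤˣ} {z : Fin n → ℝ} {Q : ℝ}

theorem abs_signSum_le_of_ramp (hQ : ∀ t, |signSum ε (fun k => ramp t (z k))| ≤ Q) :
    |signSum ε z| ≤ Q := by
  -- This kink lies below 0 and below every `z k`, where the ramp is the identity.
  convert hQ (-∑ k, |z k|) using 4 with k
  have h1 : |z k| ≤ ∑ k, |z k| :=
    Finset.single_le_sum (f := fun k => |z k|) (fun _ _ => abs_nonneg _) (Finset.mem_univ k)
  rw [ramp_of_le _ (by linarith [neg_abs_le (z k)])]
  linarith [abs_nonneg (z k)]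

theorem abs_signSum_integral_indicator_le (hQ : ∀ t, |signSum ε (fun k => ramp t (z k))| ≤ Q)
    {S : Set ℝ} (hS : IsUpperSet S) :
    |signSum ε (fun k => ∫ y in (0 : ℝ)..z k, S.indicator (fun _ => (1 : ℝ)) y)| ≤ Q := by
  rcases S.eq_empty_or_nonempty with rfl | hne
  · simpa [signSum_zero] using (abs_nonneg _).trans (hQ 0)
  by_cases hb : BddBelow S
  · simp only [integral_indicator_upperSet hS hne hb]
    exact hQ _
  · have : S = Set.univ := Set.eq_univ_of_forall fun x => by
      obtain ⟨y, hy, hyx⟩ := not_bddBelow_iff.1 hb x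
      exact hS hyx.le hy
    simpa [this] using abs_signSum_le_of_ramp hQ

/-- Layer cake: p + K is the integral over u in [0, 2K] of the indicators of its superlevel sets,
which are upper sets because p is monotone. The layers contribute 2KQ and the subtracted linear
function K z contributes KQ. -/
theorem abs_signSum_integral_monotone_le (hQ : ∀ t, |signSum ε (fun k => ramp t (z k))| ≤ Q)
    {p : ℝ → ℝ} (hp : Monotone p) {K : ℝ} (hK : ∀ y, |p y| ≤ K) :
    |signSum ε (fun k => ∫ y in (0 : ℝ)..z k, p y)| ≤ 3 * K * Q := by
  have hK0 : 0 ≤ K := (abs_nonneg _).trans (hK 0)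
  have hQ0 : 0 ≤ Q := (abs_nonneg _).trans (hQ 0)
  set S : ℝ → Set ℝ := fun u => {y | u < p y + K} with hS
  have hmeas : Measurable (Function.uncurry fun u y => (S u).indicator (fun _ => (1 : ℝ)) y) := by
    have : (Function.uncurry fun u y => (S u).indicator (fun _ => (1 : ℝ)) y) =
        {q : ℝ × ℝ | q.1 < p q.2 + K}.indicator fun _ => 1 := by
      ext ⟨u, y⟩; simp [Set.indicator, hS]
    rw [this]
    exact measurable_const.indicator
      (measurableSet_lt measurable_fst ((hp.measurable.comp measurable_snd).add_const K))
  have hlayer : ∀ y, p y + K = ∫ u in (0 : ℝ)..(2 * K), (S u).indicator (fun _ => (1 : ℝ)) y := by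
    intro y
    have h1 := abs_le.1 (hK y)
    have hfun : (fun u => (S u).indicator (fun _ => (1 : ℝ)) y) =
        (Set.Iio (p y + K)).indicator fun _ => 1 := by
      ext u; simp [Set.indicator, hS]
    rw [hfun, intervalIntegral.integral_of_le (by linarith),
      integral_indicator measurableSet_Iio, Measure.restrict_restrict measurableSet_Iio]
    have : (Set.Iio (p y + K) ∩ Set.Ioc 0 (2 * K) : Set ℝ) =ᵐ[volume]
        (Set.Ioc 0 (p y + K) : Set ℝ) := by
      have h2 : Set.Iio (p y + K) ∩ Set.Ioc 0 (2 * K) = Set.Ioo 0 (p y + K) := by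
        ext u; simp only [Set.mem_inter_iff, Set.mem_Iio, Set.mem_Ioc, Set.mem_Ioo]
        constructor
        · rintro ⟨h, h', -⟩; exact ⟨h', h⟩
        · rintro ⟨h', h⟩; exact ⟨h, h', by linarith⟩
      rw [h2]; exact Ioo_ae_eq_Ioc
    rw [Measure.restrict_congr_set this]
    simp only [integral_const, MeasurableSet.univ, measureReal_restrict_apply, Set.univ_inter,
      Real.volume_real_Ioc, smul_eq_mul, mul_one]
    rw [max_eq_left (by linarith)]; ring
  have hint : ∀ a b, IntervalIntegrable p volume a b := fun a b => hp.intervalIntegrable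
  have hswap : ∀ w : ℝ, (∫ y in (0 : ℝ)..w, p y) = (∫ u in (0 : ℝ)..(2 * K),
      ∫ y in (0 : ℝ)..w, (S u).indicator (fun _ => (1 : ℝ)) y) - K * w := by
    intro w
    have h1 : ∫ y in (0 : ℝ)..w, (p y + K) = (∫ y in (0 : ℝ)..w, p y) + K * w := by
      rw [intervalIntegral.integral_add (hint _ _) intervalIntegrable_const]
      simp [mul_comm]
    rw [eq_sub_iff_add_eq, ← h1, intervalIntegral.integral_congr fun y _ => hlayer y]
    refine intervalIntegral_intervalIntegral_swap ?_
    refine Measure.integrableOn_of_bounded (M := 1) ?_ ?_ ?_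
    · rw [Measure.volume_eq_prod, Measure.prod_prod]
      exact (ENNReal.mul_lt_top (by simp [Set.uIoc]) (by simp [Set.uIoc])).ne
    · exact (hmeas.comp measurable_swap).aestronglyMeasurable
    · refine Filter.Eventually.of_forall fun q => ?_
      simp only [Function.uncurry]
      refine (norm_indicator_le_norm_self _ _).trans (by simp)
  simp only [hswap]
  rw [signSum_sub, show (fun k => K * z k) = fun k => K • z k from rfl, signSum_smul]
  have hpart : signSum ε (fun k => ∫ u in (0 : ℝ)..(2 * K),
      ∫ y in (0 : ℝ)..z k, (S u).indicator (fun _ => (1 : ℝ)) y) =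
      ∫ u in (0 : ℝ)..(2 * K), signSum ε fun k =>
        ∫ y in (0 : ℝ)..z k, (S u).indicator (fun _ => (1 : ℝ)) y := by
    simp only [signSum]
    rw [intervalIntegral.integral_finsetSum]
    · simp only [intervalIntegral.integral_smul]
    · intro k _
      simp only [smul_eq_mul]
      refine IntervalIntegrable.const_mul ?_ _
      refine (intervalIntegrable_const (c := |z k|)).mono_fun ?_ ?_
      · refine StronglyMeasurable.aestronglyMeasurable ?_
        simp only [intervalIntegral.intervalIntegral_eq_integral_uIoc, smul_eq_mul]
        exact (hmeas.stronglyMeasurable.integral_prod_right'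
          (ν := volume.restrict (Set.uIoc 0 (z k)))).const_mul _
      · refine Filter.Eventually.of_forall fun u => ?_
        refine (intervalIntegral.norm_integral_le_of_norm_le_const (C := 1) fun y _ =>
          (norm_indicator_le_norm_self _ _).trans (by simp)).trans (by simp)
  rw [hpart]
  have hmain : ‖∫ u in (0 : ℝ)..(2 * K), signSum ε fun k =>
      ∫ y in (0 : ℝ)..z k, (S u).indicator (fun _ => (1 : ℝ)) y‖ ≤ Q * |2 * K - 0| := by
    refine intervalIntegral.norm_integral_le_of_norm_le_const fun u _ => ?_
    refine abs_signSum_integral_indicator_le hQ fun x y hxy hx => ?_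
    simp only [hS, Set.mem_ofPred_eq] at hx ⊢
    linarith [hp hxy]
  rw [sub_zero, abs_of_nonneg (by linarith), Real.norm_eq_abs] at hmain
  have h2 := abs_signSum_le_of_ramp hQ
  refine (abs_sub _ _).trans ?_
  rw [smul_eq_mul, abs_mul, abs_of_nonneg hK0]
  nlinarith

end

/-- Jordan decomposition σ' = p − q with p, q monotone. Both are bounded: p − q by the Lipschitz
constant, and p + q because its increments are variations of σ'. Integrating from 0 and applying the
monotone case to each gives 3K + 3K. -/
theorem exists_ramp_bound {σ : ℝ → ℝ} (hσ : LipschitzWith 1 σ)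
    (hbv : BoundedVariationOn (deriv σ) Set.univ) :
    ∃ K : ℝ, 0 ≤ K ∧ ∀ (n : ℕ) (ε : Fin n → ℤˣ) (z : Fin n → ℝ) (Q : ℝ),
      (∀ t, |signSum ε (fun k => ramp t (z k))| ≤ Q) →
      |signSum ε (fun k => σ (z k) - σ 0)| ≤ K * Q := by
  obtain ⟨p, q, hp, hq, hpq, hvar⟩ :=
    hbv.locallyBoundedVariationOn.exists_monotoneOn_sub_monotoneOn'
  rw [monotoneOn_univ] at hp hq
  have hd : ∀ y, deriv σ y = p y - q y := fun y => by rw [hpq]; rfl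
  have hd1 : ∀ y, |p y - q y| ≤ 1 := fun y => by
    rw [← hd]; simpa using norm_deriv_le_of_lipschitz hσ (x₀ := y)
  set V := (eVariationOn (deriv σ) Set.univ).toReal
  set K := |p 0 + q 0| + V + 1
  have hsum : ∀ y, |p y + q y| ≤ |p 0 + q 0| + V := fun y => by
    have h1 := hvar 0 trivial y trivial
    have h2 : p y + q y = (p 0 + q 0) + variationOnFromTo (deriv σ) Set.univ 0 y := by linarith
    rw [h2]
    exact (abs_add_le _ _).trans (add_le_add_right (variationOnFromTo.abs_le_eVariationOn hbv) _)
  have hV : 0 ≤ V := ENNReal.toReal_nonneg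
  have hpK : ∀ y, |p y| ≤ K := fun y => by
    have h1 := abs_le.1 (hd1 y); have h2 := abs_le.1 (hsum y)
    exact abs_le.2 ⟨by linarith, by linarith⟩
  have hqK : ∀ y, |q y| ≤ K := fun y => by
    have h1 := abs_le.1 (hd1 y); have h2 := abs_le.1 (hsum y)
    exact abs_le.2 ⟨by linarith, by linarith⟩
  refine ⟨6 * K, by positivity, fun n ε z Q hQ => ?_⟩
  have h1 : (fun k => σ (z k) - σ 0) =
      fun k => (∫ y in (0 : ℝ)..z k, p y) - ∫ y in (0 : ℝ)..z k, q y := by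
    funext k
    rw [← integral_deriv_of_lipschitzWith hσ,
      ← intervalIntegral.integral_sub hp.intervalIntegrable hq.intervalIntegrable]
    simp only [hd]
  rw [h1, signSum_sub]
  refine (abs_sub _ _).trans ?_
  linarith [abs_signSum_integral_monotone_le hQ hp hpK, abs_signSum_integral_monotone_le hQ hq hqK]

/-! ### Complexity of sums, constants and ramps. -/

section rad
variable {n : ℕ} {ι : Type*}

theorem rad_add_le [Nonempty ι] {a b : ι → Fin n → ℝ} {M M' : ℝ} (ha : ∀ i k, |a i k| ≤ M)
    (hb : ∀ i k, |b i k| ≤ M') : rad (fun i k => a i k + b i k) ≤ rad a + rad b := by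
  unfold rad
  rw [← signAvg_add]
  refine signAvg_mono fun ε => ciSup_le fun i => ?_
  rw [signSum_add]
  exact add_le_add (le_ciSup (bddAbove_signSum ha ε) i) (le_ciSup (bddAbove_signSum hb ε) i)

theorem signAvg_abs_signSum_const_le (c : ℝ) :
    signAvg (fun ε : Fin n → ℤˣ => |signSum ε fun _ => c|) ≤ √n * |c| :=
  signAvg_norm_signSum_le (E := ℝ) (fun _ => le_rfl) (abs_nonneg c)

theorem rad_const_le [Nonempty ι] {t : ι → ℝ} {M : ℝ} (ht : ∀ i, |t i| ≤ M) :
    rad (fun i (_ : Fin n) => t i) ≤ M * √n := by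
  have h1 := signAvg_abs_signSum_const_le (n := n) 1
  rw [abs_one, mul_one] at h1
  have hM : 0 ≤ M := (abs_nonneg _).trans (ht (Classical.arbitrary ι))
  refine le_trans ?_ (mul_le_mul_of_nonneg_left h1 hM)
  rw [← signAvg_const_mul]
  refine signAvg_mono fun ε => ciSup_le fun i => ?_
  have : signSum ε (fun _ => t i) = t i * signSum ε fun _ => (1 : ℝ) := by
    rw [← smul_eq_mul, ← signSum_smul]; simp
  refine (le_of_eq this).trans ?_
  refine (le_abs_self _).trans ?_
  rw [abs_mul]
  gcongr
  exact ht i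

theorem rad_comp_le {ι' : Type*} [Nonempty ι'] {a : ι → Fin n → ℝ} {M : ℝ}
    (ha : ∀ i k, |a i k| ≤ M) (f : ι' → ι) : rad (fun i => a (f i)) ≤ rad a :=
  signAvg_mono fun ε => ciSup_le fun i => le_ciSup (bddAbove_signSum ha ε) (f i)

/-- Shifted ramps of a bounded class are no more complex than the class, up to the cost of the
shifts. -/
theorem rad_ramp_le [Nonempty ι] {a : ι → Fin n → ℝ} {M : ℝ} (hM : 0 ≤ M) (ha : ∀ i k, |a i k| ≤ M) :
    rad (fun (p : Set.Icc (-M) M × ι) k => ramp p.1 (a p.2 k)) ≤ rad a + 2 * (M * √n) := by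
  have : Nonempty (Set.Icc (-M) M) := ⟨⟨0, by simpa using hM⟩⟩
  have ht : ∀ p : Set.Icc (-M) M × ι, |-(p.1 : ℝ)| ≤ M := fun p => by
    rw [abs_neg]; exact abs_le.2 p.1.2
  have hmax : ∀ x y : ℝ, |max x 0 - max y 0| ≤ |x - y| := fun x y =>
    (abs_max_sub_max_le_abs x y 0).trans le_rfl
  have hmax0 : ∀ x : ℝ, |max x 0| ≤ |x| := fun x => by simpa using hmax x 0
  have h1 : ∀ (p : Set.Icc (-M) M × ι) (k : Fin n), |a p.2 k + -(p.1 : ℝ)| ≤ M + M := fun p k =>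
    (abs_add_le _ _).trans (add_le_add (ha _ _) (ht p))
  -- The positive part is a contraction of the shifted class; the shift is constant in the sample
  -- and costs only M√n. The normalizing constant of the ramp costs the same again.
  have e1 : rad (fun (p : Set.Icc (-M) M × ι) k => max (a p.2 k + -(p.1 : ℝ)) 0) ≤
      rad a + M * √n := by
    refine (rad_le_rad h1 (fun p k => (hmax0 _).trans (h1 p k)) fun p q k => hmax _ _).trans ?_
    have e0 := rad_add_le (a := fun p : Set.Icc (-M) M × ι => a p.2)
      (b := fun p (_ : Fin n) => -(p.1 : ℝ)) (fun p k => ha p.2 k) fun p _ => ht p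
    exact e0.trans (add_le_add (rad_comp_le ha Prod.snd) (rad_const_le ht))
  have e2 : rad (fun (p : Set.Icc (-M) M × ι) (_ : Fin n) => -max (-(p.1 : ℝ)) 0) ≤ M * √n :=
    rad_const_le fun p => by rw [abs_neg]; exact (hmax0 _).trans (ht p)
  have e3 := rad_add_le (a := fun (p : Set.Icc (-M) M × ι) (k : Fin n) =>
    max (a p.2 k + -(p.1 : ℝ)) 0) (b := fun p _ => -max (-(p.1 : ℝ)) 0)
    (fun p k => (hmax0 _).trans (h1 p k))
    (fun p _ => by rw [abs_neg]; exact (hmax0 _).trans (ht p))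
  simp only [ramp, sub_eq_add_neg] at e3 ⊢
  linarith

end rad

/-! ### Effect of one layer on the complexity. -/

section rows
variable {d m n : ℕ} {Θ : Type} {RW RU Rx H : ℝ}
  {x : Fin n → EuclideanSpace ℝ (Fin d)} {h : Θ → Fin n → EuclideanSpace ℝ (Fin m)}

/-- The index set of the class of preactivations of a single neuron. -/
abbrev RowIndex (d m : ℕ) (Θ : Type) (RW RU : ℝ) : Type :=
  {p : EuclideanSpace ℝ (Fin d) × EuclideanSpace ℝ (Fin m) × Θ // ‖p.1‖ ≤ RW ∧ ‖p.2.1‖ ≤ RU}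

/-- The preactivations `w·x + u·h` of a single neuron on a sample. -/
noncomputable def rowFamily (RW RU : ℝ) (x : Fin n → EuclideanSpace ℝ (Fin d))
    (h : Θ → Fin n → EuclideanSpace ℝ (Fin m)) (p : RowIndex d m Θ RW RU) (k : Fin n) : ℝ :=
  inner ℝ p.1.1 (x k) + inner ℝ p.1.2.1 (h p.1.2.2 k)

theorem abs_rowFamily_le (hRW : 0 ≤ RW) (hRU : 0 ≤ RU) (hx : ∀ k, ‖x k‖ ≤ Rx)
    (hh : ∀ θ k, ‖h θ k‖ ≤ H) (p : RowIndex d m Θ RW RU) (k : Fin n) :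
    |rowFamily RW RU x h p k| ≤ RW * Rx + RU * H :=
  (abs_add_le _ _).trans (add_le_add
    ((abs_real_inner_le_norm _ _).trans (mul_le_mul p.2.1 (hx k) (norm_nonneg _) hRW))
    ((abs_real_inner_le_norm _ _).trans (mul_le_mul p.2.2 (hh _ k) (norm_nonneg _) hRU)))

/-- Cauchy–Schwarz pulls the weights out of the signed sums. The weights `w`, `u` range
independently of θ, so the same bound serves every neuron. -/
theorem rad_rowFamily_le [Nonempty Θ] (hRW : 0 ≤ RW) (hRU : 0 ≤ RU) (hRx : 0 ≤ Rx)
    (hx : ∀ k, ‖x k‖ ≤ Rx) (hh : ∀ θ k, ‖h θ k‖ ≤ H) :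
    rad (rowFamily RW RU x h) ≤
      RW * (√n * Rx) + RU * signAvg fun ε => ⨆ θ, ‖signSum ε (h θ)‖ := by
  have : Nonempty (RowIndex d m Θ RW RU) := ⟨⟨(0, 0, Classical.arbitrary Θ), by
    simpa using ⟨hRW, hRU⟩⟩⟩
  refine le_trans ?_ (add_le_add_left
    (mul_le_mul_of_nonneg_left (signAvg_norm_signSum_le hx hRx) hRW) _)
  rw [← signAvg_const_mul, ← signAvg_const_mul, ← signAvg_add]
  refine signAvg_mono fun ε => ciSup_le fun p => ?_
  have h1 : signSum ε (rowFamily RW RU x h p) =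
      inner ℝ p.1.1 (signSum ε x) + inner ℝ p.1.2.1 (signSum ε (h p.1.2.2)) := by
    rw [inner_signSum, inner_signSum, ← signSum_add]; rfl
  rw [h1]
  refine add_le_add ((real_inner_le_norm _ _).trans (by gcongr; exact p.2.1))
    ((real_inner_le_norm _ _).trans (mul_le_mul p.2.2 ?_ (norm_nonneg _) hRU))
  exact le_ciSup (bddAbove_norm_signSum hh ε) p.1.2.2

/-- A row of a matrix as a Euclidean vector. -/
def row {p q : ℕ} (A : Matrix (Fin p) (Fin q) ℝ) (i : Fin p) : EuclideanSpace ℝ (Fin q) :=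
  WithLp.toLp 2 (A i)

theorem sum_norm_row_sq {p q : ℕ} (A : Matrix (Fin p) (Fin q) ℝ) :
    ∑ i, ‖row A i‖ ^ 2 = frobNorm A ^ 2 := by
  rw [frobNorm, Real.sq_sqrt (by positivity)]
  simp [row, EuclideanSpace.norm_sq_eq]

theorem frobNorm_nonneg {p q : ℕ} (A : Matrix (Fin p) (Fin q) ℝ) : 0 ≤ frobNorm A :=
  Real.sqrt_nonneg _

theorem norm_row_le {p q : ℕ} (A : Matrix (Fin p) (Fin q) ℝ) (i : Fin p) :
    ‖row A i‖ ≤ frobNorm A := by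
  refine le_of_sq_le_sq ?_ (frobNorm_nonneg A)
  rw [← sum_norm_row_sq]
  exact Finset.single_le_sum (f := fun i => ‖row A i‖ ^ 2) (fun _ _ => sq_nonneg _)
    (Finset.mem_univ i)

theorem preact_eq (W : Matrix (Fin m) (Fin d) ℝ) (U : Matrix (Fin m) (Fin m) ℝ)
    (x : EuclideanSpace ℝ (Fin d)) (h : EuclideanSpace ℝ (Fin m)) (i : Fin m) :
    preact W U x h i = inner ℝ (row W i) x + inner ℝ (row U i) h := by
  simp [preact, row, PiLp.inner_apply, Matrix.mulVec, dotProduct, mul_comm]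

theorem norm_preact_le (W : Matrix (Fin m) (Fin d) ℝ) (U : Matrix (Fin m) (Fin m) ℝ)
    (x : EuclideanSpace ℝ (Fin d)) (h : EuclideanSpace ℝ (Fin m)) :
    ‖(WithLp.toLp 2 (preact W U x h) : EuclideanSpace ℝ (Fin m))‖ ≤
      frobNorm W * ‖x‖ + frobNorm U * ‖h‖ := by
  have key : ∀ {q : ℕ} (A : Matrix (Fin m) (Fin q) ℝ) (y : EuclideanSpace ℝ (Fin q)),
      ‖(WithLp.toLp 2 (fun i => (inner ℝ (row A i) y : ℝ)) : EuclideanSpace ℝ (Fin m))‖ ≤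
        frobNorm A * ‖y‖ := by
    intro q A y
    refine le_of_sq_le_sq ?_ (mul_nonneg (frobNorm_nonneg A) (norm_nonneg y))
    rw [mul_pow, ← sum_norm_row_sq, Finset.sum_mul, EuclideanSpace.norm_sq_eq]
    refine Finset.sum_le_sum fun i _ => ?_
    rw [← mul_pow]
    exact pow_le_pow_left₀ (norm_nonneg _) (norm_inner_le_norm _ _) 2
  have h1 : (WithLp.toLp 2 (preact W U x h) : EuclideanSpace ℝ (Fin m)) =
      WithLp.toLp 2 (fun i => (inner ℝ (row W i) x : ℝ)) +
        WithLp.toLp 2 (fun i => (inner ℝ (row U i) h : ℝ)) := by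
    ext i; simp [preact_eq]
  rw [h1]
  exact (norm_add_le _ _).trans (add_le_add (key W x) (key U h))

/-- The output of one layer. -/
def layer (σ : ℝ → ℝ) (W : Matrix (Fin m) (Fin d) ℝ) (U : Matrix (Fin m) (Fin m) ℝ)
    (x : EuclideanSpace ℝ (Fin d)) (h : EuclideanSpace ℝ (Fin m)) : EuclideanSpace ℝ (Fin m) :=
  WithLp.toLp 2 fun i => σ (preact W U x h i)

theorem norm_const_eq (c : ℝ) :
    ‖(WithLp.toLp 2 (fun _ => c) : EuclideanSpace ℝ (Fin m))‖ = √m * |c| := by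
  rw [EuclideanSpace.norm_eq]
  simp [Real.sqrt_sq_eq_abs]

theorem norm_layer_le {σ : ℝ → ℝ} (hσ : LipschitzWith 1 σ) (W : Matrix (Fin m) (Fin d) ℝ)
    (U : Matrix (Fin m) (Fin m) ℝ) (x : EuclideanSpace ℝ (Fin d)) (h : EuclideanSpace ℝ (Fin m)) :
    ‖layer σ W U x h‖ ≤ frobNorm W * ‖x‖ + frobNorm U * ‖h‖ + √m * |σ 0| := by
  have h1 : layer σ W U x h = WithLp.toLp 2 (fun i => σ (preact W U x h i) - σ 0) +
      WithLp.toLp 2 (fun _ => σ 0) := by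
    ext i; simp [layer]
  rw [h1]
  refine (norm_add_le _ _).trans (add_le_add ?_ (norm_const_eq _).le)
  refine le_trans ?_ (norm_preact_le W U x h)
  refine le_of_sq_le_sq ?_ (norm_nonneg _)
  rw [EuclideanSpace.norm_sq_eq, EuclideanSpace.norm_sq_eq]
  refine Finset.sum_le_sum fun i _ => pow_le_pow_left₀ (norm_nonneg _) ?_ 2
  simpa [Real.dist_eq] using hσ.dist_le_mul (preact W U x h i) 0

/-- The weights `s i` allow each neuron its own scale; only their ℓ² norm matters. The part σ(0),
constant over the sample, is split off. -/
theorem norm_signSum_layer_le (σ : ℝ → ℝ) (W : Matrix (Fin m) (Fin d) ℝ)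
    (U : Matrix (Fin m) (Fin m) ℝ) (g : Fin n → EuclideanSpace ℝ (Fin m)) (ε : Fin n → ℤˣ)
    {s : Fin m → ℝ} {C Q : ℝ} (hC : 0 ≤ C) (hQ : 0 ≤ Q) (hs : ∑ i, s i ^ 2 ≤ C ^ 2)
    (hb : ∀ i, |signSum ε fun k => σ (preact W U (x k) (g k) i) - σ 0| ≤ s i * Q) :
    ‖signSum ε fun k => layer σ W U (x k) (g k)‖ ≤
      C * Q + √m * |σ 0| * |signSum ε fun _ => (1 : ℝ)| := by
  have h1 : signSum ε (fun k => layer σ W U (x k) (g k)) =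
      WithLp.toLp 2 (fun i => signSum ε fun k => σ (preact W U (x k) (g k) i) - σ 0) +
      WithLp.toLp 2 (fun _ => σ 0 * signSum ε fun _ => (1 : ℝ)) := by
    ext i
    have h2 := map_signSum (EuclideanSpace.proj (𝕜 := ℝ) i).toLinearMap ε
      fun k => layer σ W U (x k) (g k)
    have h3 : (signSum ε fun k => layer σ W U (x k) (g k)) i =
      signSum ε fun k => σ (preact W U (x k) (g k) i) := h2
    rw [h3]
    simp only [PiLp.add_apply]
    rw [← smul_eq_mul, ← signSum_smul, ← signSum_add]
    simp
  rw [h1]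
  refine (norm_add_le _ _).trans (add_le_add ?_ (by rw [norm_const_eq, abs_mul, mul_assoc]))
  refine le_of_sq_le_sq ?_ (mul_nonneg hC hQ)
  rw [EuclideanSpace.norm_sq_eq, mul_pow]
  refine le_trans ?_ (mul_le_mul_of_nonneg_right hs (sq_nonneg Q))
  rw [Finset.sum_mul]
  refine Finset.sum_le_sum fun i _ => ?_
  rw [← mul_pow]
  exact pow_le_pow_left₀ (norm_nonneg _) (hb i) 2

/-- `κ` controls how much one layer of width `m` with activation `σ` increases Rademacher
complexities, uniformly in the sample and in the class of inputs. -/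
def IsLayerConst (σ : ℝ → ℝ) (m : ℕ) (κ : ℝ) : Prop :=
  ∀ (d n : ℕ) (Θ : Type) [Nonempty Θ] (RW RU Rx H : ℝ), 0 ≤ RW → 0 ≤ RU → 0 ≤ Rx → 0 ≤ H →
    ∀ (x : Fin n → EuclideanSpace ℝ (Fin d)) (h : Θ → Fin n → EuclideanSpace ℝ (Fin m))
      (W : Θ → Matrix (Fin m) (Fin d) ℝ) (U : Θ → Matrix (Fin m) (Fin m) ℝ),
      (∀ k, ‖x k‖ ≤ Rx) → (∀ θ k, ‖h θ k‖ ≤ H) →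
      (∀ θ, frobNorm (W θ) ≤ RW) → (∀ θ, frobNorm (U θ) ≤ RU) →
      signAvg (fun ε => ⨆ θ, ‖signSum ε fun k => layer σ (W θ) (U θ) (x k) (h θ k)‖) ≤
        κ * ((RW * Rx + √m * |σ 0|) * √n + RU * H * √n +
          RU * signAvg fun ε => ⨆ θ, ‖signSum ε (h θ)‖)

theorem signAvg_iSup_layer_le [Nonempty Θ] {σ : ℝ → ℝ} {W : Θ → Matrix (Fin m) (Fin d) ℝ}
    {U : Θ → Matrix (Fin m) (Fin m) ℝ} {C : ℝ} (hC : 0 ≤ C) {Q : (Fin n → ℤˣ) → ℝ}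
    (hQ : ∀ ε, 0 ≤ Q ε)
    (hb : ∀ θ, ∃ s : Fin m → ℝ, ∑ i, s i ^ 2 ≤ C ^ 2 ∧ ∀ ε i,
      |signSum ε fun k => σ (preact (W θ) (U θ) (x k) (h θ k) i) - σ 0| ≤ s i * Q ε) :
    signAvg (fun ε => ⨆ θ, ‖signSum ε fun k => layer σ (W θ) (U θ) (x k) (h θ k)‖) ≤
      C * signAvg Q + √m * |σ 0| * √n := by
  have h1 := signAvg_abs_signSum_const_le (n := n) 1
  rw [abs_one, mul_one] at h1
  refine le_trans ?_ (add_le_add_right (mul_le_mul_of_nonneg_left h1 (by positivity)) _)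
  rw [← signAvg_const_mul, ← signAvg_const_mul, ← signAvg_add]
  refine signAvg_mono fun ε => ciSup_le fun θ => ?_
  obtain ⟨s, hs, hsb⟩ := hb θ
  exact norm_signSum_layer_le σ (W θ) (U θ) (h θ) ε hC (hQ ε) hs (hsb ε)

/-- All m neurons share one scalar class, so all weights are 1 and their ℓ² norm is √m. The 2 comes
from the absolute values, the 1 from the term with σ(0). -/
theorem isLayerConst_of_lipschitzWith {σ : ℝ → ℝ} (hσ : LipschitzWith 1 σ) (m : ℕ) :
    IsLayerConst σ m (2 * √m + 1) := by
  intro d n Θ _ RW RU Rx H hRW hRU hRx hH x h W U hx hh hW hU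
  have : Nonempty (RowIndex d m Θ RW RU) := ⟨⟨(0, 0, Classical.arbitrary Θ), by
    simpa using ⟨hRW, hRU⟩⟩⟩
  have ha := abs_rowFamily_le hRW hRU hx hh
  set a := rowFamily RW RU x h
  set A := signAvg fun ε => ⨆ θ, ‖signSum ε (h θ)‖
  have hA : 0 ≤ A := signAvg_nonneg fun ε => Real.iSup_nonneg fun θ => norm_nonneg _
  have hσ1 : ∀ y z, |σ y - σ z| ≤ |y - z| := fun y z => by
    simpa [Real.dist_eq] using hσ.dist_le_mul y z
  have hb : ∀ p k, |σ (a p k) - σ 0| ≤ RW * Rx + RU * H := fun p k =>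
    (hσ1 _ _).trans (by simpa using ha p k)
  have hbdd : ∀ ε : Fin n → ℤˣ,
      BddAbove (Set.range fun p => |signSum ε fun k => σ (a p k) - σ 0|) := fun ε =>
    bddAbove_norm_signSum (E := ℝ) hb ε
  have hmain := signAvg_iSup_layer_le (x := x) (h := h) (σ := σ) (W := W) (U := U)
    (C := √m) (Real.sqrt_nonneg _)
    (Q := fun ε => ⨆ p, |signSum ε fun k => σ (a p k) - σ 0|)
    (fun ε => Real.iSup_nonneg fun p => abs_nonneg _) fun θ => ⟨fun _ => 1, by simp, fun ε i => by
      rw [one_mul]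
      have := le_ciSup (hbdd ε) ⟨(row (W θ) i, row (U θ) i, θ),
        (norm_row_le _ _).trans (hW θ), (norm_row_le _ _).trans (hU θ)⟩
      simp only [preact_eq]
      exact this⟩
  have hr : rad (fun p k => σ (a p k) - σ 0) ≤ rad a :=
    rad_le_rad ha hb fun p q k => by simpa using hσ1 (a p k) (a q k)
  have hr2 := signAvg_iSup_abs_le hb ⟨(0, 0, Classical.arbitrary Θ), by simpa using ⟨hRW, hRU⟩⟩
    fun k => by simp [a, rowFamily]
  have hr3 := rad_rowFamily_le hRW hRU hRx hx hh
  have h4 : signAvg (fun ε => ⨆ p, |signSum ε fun k => σ (a p k) - σ 0|) ≤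
      2 * (RW * (√n * Rx) + RU * A) := by linarith
  have h5 := mul_le_mul_of_nonneg_left h4 (Real.sqrt_nonneg (m : ℝ))
  have p1 : 0 ≤ √(m : ℝ) * (RU * H * √n) := by positivity
  have p2 : 0 ≤ √(m : ℝ) * (√m * |σ 0| * √n) := by positivity
  have p3 : 0 ≤ RW * Rx * √n := by positivity
  have p4 : 0 ≤ RU * H * √n := by positivity
  have p5 : 0 ≤ RU * A := by positivity
  nlinarith

/-- Neuron i is s_i times a neuron with weights in the full balls, and ramps absorb the factor s_i.
As ∑ s_i² ≤ 2, the width disappears. With C = 2, the R_W R_x term collects 2K · 2 · (1 + 2) = 12K;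
the other terms need less. -/
theorem isLayerConst_of_ramp_bound {σ : ℝ → ℝ} {K : ℝ} (hK : 0 ≤ K)
    (hramp : ∀ (n : ℕ) (ε : Fin n → ℤˣ) (z : Fin n → ℝ) (Q : ℝ),
      (∀ t, |signSum ε (fun k => ramp t (z k))| ≤ Q) →
      |signSum ε (fun k => σ (z k) - σ 0)| ≤ K * Q) (m : ℕ) :
    IsLayerConst σ m (12 * K + 1) := by
  intro d n Θ _ RW RU Rx H hRW hRU hRx hH x h W U hx hh hW hU
  have : Nonempty (RowIndex d m Θ RW RU) := ⟨⟨(0, 0, Classical.arbitrary Θ), by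
    simpa using ⟨hRW, hRU⟩⟩⟩
  have ha := abs_rowFamily_le hRW hRU hx hh
  have hr3 := rad_rowFamily_le hRW hRU hRx hx hh
  set a := rowFamily RW RU x h with ha_def
  set A := signAvg fun ε => ⨆ θ, ‖signSum ε (h θ)‖
  have hA : 0 ≤ A := signAvg_nonneg fun ε => Real.iSup_nonneg fun θ => norm_nonneg _
  set M := RW * Rx + RU * H
  have hM : 0 ≤ M := by positivity
  have : Nonempty (Set.Icc (-M) M) := ⟨⟨0, by simpa using hM⟩⟩
  set r : Set.Icc (-M) M × RowIndex d m Θ RW RU → Fin n → ℝ := fun p k => ramp p.1 (a p.2 k)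
  have hr : ∀ p k, |r p k| ≤ M := fun p k => by
    have h1 := (lipschitzWith_ramp p.1).dist_le_mul (a p.2 k) 0
    rw [ramp_zero] at h1
    simp only [Real.dist_eq, sub_zero, NNReal.coe_one, one_mul] at h1
    exact h1.trans (ha _ _)
  set Q : (Fin n → ℤˣ) → ℝ := fun ε => ⨆ p, |signSum ε (r p)|
  have hbdd : ∀ ε : Fin n → ℤˣ, BddAbove (Set.range fun p => |signSum ε (r p)|) := fun ε =>
    bddAbove_norm_signSum (E := ℝ) hr ε
  have hQ : ∀ ε, 0 ≤ Q ε := fun ε => Real.iSup_nonneg fun p => abs_nonneg _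
  have hQt : ∀ ε t p, |signSum ε fun k => ramp t (a p k)| ≤ Q ε := fun ε t p => by
    have h1 := le_ciSup (hbdd ε)
      (⟨max (-M) (min M t), le_max_left _ _, max_le (by linarith) (min_le_left _ _)⟩, p)
    simp only [r, ramp_projIcc (ha p _)] at h1
    exact h1
  have hQavg : signAvg Q ≤ 2 * (RW * (√n * Rx) + RU * A + 2 * (M * √n)) := by
    have h1 := signAvg_iSup_abs_le hr
      (⟨0, by simpa using hM⟩, ⟨(0, 0, Classical.arbitrary Θ), by simpa using ⟨hRW, hRU⟩⟩)
      fun k => by simp [r, a, rowFamily, ramp_zero]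
    have h2 := rad_ramp_le hM ha
    linarith
  have hmain := signAvg_iSup_layer_le (x := x) (h := h) (σ := σ) (W := W) (U := U)
    (C := 2) (by norm_num) (Q := fun ε => K * Q ε) (fun ε => mul_nonneg hK (hQ ε)) fun θ => by
      -- One scale must serve both rows; each of the two sums of squares is at most 1. If a radius
      -- is 0, the quotient is 0 by convention, which is harmless as the row vanishes.
      set s : Fin m → ℝ := fun i => √((‖row (W θ) i‖ / RW) ^ 2 + (‖row (U θ) i‖ / RU) ^ 2)
      have hs2 : ∀ i, s i ^ 2 = (‖row (W θ) i‖ / RW) ^ 2 + (‖row (U θ) i‖ / RU) ^ 2 := fun i =>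
        Real.sq_sqrt (by positivity)
      have hs0 : ∀ i, 0 ≤ s i := fun i => Real.sqrt_nonneg _
      have hle : ∀ {q : ℕ} {B : Matrix (Fin m) (Fin q) ℝ} {R : ℝ}, 0 ≤ R → frobNorm B ≤ R →
          ∀ i, ‖row B i‖ = ‖row B i‖ / R * R := fun {q B R} hR hB i => by
        rcases hR.eq_or_lt with rfl | hR
        · have := (norm_row_le B i).trans hB
          simpa using le_antisymm this (norm_nonneg _)
        · field_simp
      have hsq : ∀ {q : ℕ} {B : Matrix (Fin m) (Fin q) ℝ} {R : ℝ}, 0 ≤ R → frobNorm B ≤ R →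
          ∑ i, (‖row B i‖ / R) ^ 2 ≤ 1 := fun {q B R} hR hB => by
        simp only [div_pow]
        rw [← Finset.sum_div, sum_norm_row_sq, ← div_pow]
        exact pow_le_one₀ (div_nonneg (frobNorm_nonneg B) hR) (div_le_one_of_le₀ hB hR)
      have hsW : ∀ i, ‖row (W θ) i‖ ≤ s i * RW := fun i => by
        rw [hle hRW (hW θ) i]
        exact mul_le_mul_of_nonneg_right (Real.le_sqrt_of_sq_le
          (by nlinarith [sq_nonneg (‖row (U θ) i‖ / RU)])) hRW
      have hsU : ∀ i, ‖row (U θ) i‖ ≤ s i * RU := fun i => by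
        rw [hle hRU (hU θ) i]
        exact mul_le_mul_of_nonneg_right (Real.le_sqrt_of_sq_le
          (by nlinarith [sq_nonneg (‖row (W θ) i‖ / RW)])) hRU
      refine ⟨s, ?_, fun ε i => ?_⟩
      · simp only [hs2, Finset.sum_add_distrib]
        linarith [hsq hRW (hW θ), hsq hRU (hU θ)]
      have hkey : ∃ p : RowIndex d m Θ RW RU, ∀ k,
          preact (W θ) (U θ) (x k) (h θ k) i = s i * a p k := by
        rcases (hs0 i).eq_or_lt with h0 | hpos
        · have hw := hsW i; have hu := hsU i
          rw [← h0, zero_mul, norm_le_zero_iff] at hw hu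
          exact ⟨Classical.arbitrary _, fun k => by rw [preact_eq, hw, hu, ← h0]; simp⟩
        · refine ⟨⟨((s i)⁻¹ • row (W θ) i, (s i)⁻¹ • row (U θ) i, θ), ?_, ?_⟩, fun k => ?_⟩
          · rw [norm_smul, norm_inv, Real.norm_eq_abs, abs_of_pos hpos, inv_mul_le_iff₀ hpos]
            exact hsW i
          · rw [norm_smul, norm_inv, Real.norm_eq_abs, abs_of_pos hpos, inv_mul_le_iff₀ hpos]
            exact hsU i
          · rw [preact_eq, ha_def]
            simp only [rowFamily, inner_smul_left]
            simp only [conj_trivial]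
            field_simp
      obtain ⟨p, hp⟩ := hkey
      simp only [hp]
      refine (hramp n ε (fun k => s i * a p k) (s i * Q ε) fun t => ?_).trans (by
        rw [mul_left_comm])
      rcases (hs0 i).eq_or_lt with h0 | hpos
      · rw [← h0]; simp [ramp_zero, signSum_zero]
      -- Scaling moves the kink to t / s_i; the supremum over all kinks makes this free.
      · have h1 : (fun k => ramp t (s i * a p k)) = fun k => s i • ramp (t / s i) (a p k) := by
          funext k
          rw [smul_eq_mul, ← ramp_mul hpos.le]
          congr 1
          field_simp
        rw [h1, signSum_smul, smul_eq_mul, abs_mul, abs_of_pos hpos]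
        exact mul_le_mul_of_nonneg_left (hQt ε _ p) hpos.le
  rw [signAvg_const_mul] at hmain
  refine hmain.trans ?_
  have h5 := mul_le_mul_of_nonneg_left hQavg hK
  have p1 : 0 ≤ K * (√m * |σ 0| * √n) := by positivity
  have p3 : 0 ≤ RW * Rx * √n := by positivity
  have p4 : 0 ≤ RU * H * √n := by positivity
  have p5 : 0 ≤ RU * A := by positivity
  have p6 := mul_nonneg hK p3
  have p7 := mul_nonneg hK p4
  have p8 := mul_nonneg hK p5
  simp only [M] at h5
  nlinarith

end rows

/-! ### The recursion over time. -/

section hidden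
variable {d m n : ℕ} {σ : ℝ → ℝ} {RW RU Rx α : ℝ}

theorem hidden_succ (σ : ℝ → ℝ) (α β : ℝ) (W : Matrix (Fin m) (Fin d) ℝ)
    (U : Matrix (Fin m) (Fin m) ℝ) (k : ℕ) (X : Fin (k + 1) → EuclideanSpace ℝ (Fin d)) :
    hidden σ α β W U (k + 1) X =
      α • layer σ W U (X (Fin.last k)) (hidden σ α β W U k fun t => X t.castSucc) +
        β • hidden σ α β W U k fun t => X t.castSucc := rfl

theorem norm_hidden_le (hσ : LipschitzWith 1 σ) (hRW : 0 ≤ RW) (hRU : 0 ≤ RU) (hRx : 0 ≤ Rx)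
    (hα : 0 ≤ α) (hα1 : α ≤ 1) {W : Matrix (Fin m) (Fin d) ℝ} {U : Matrix (Fin m) (Fin m) ℝ}
    (hW : frobNorm W ≤ RW) (hU : frobNorm U ≤ RU) (T : ℕ) (hT : α * (4 * T * RU) ≤ 1)
    (X : Fin T → EuclideanSpace ℝ (Fin d)) (hX : ∀ t, ‖X t‖ ≤ Rx) :
    ‖hidden σ α (1 - α) W U T X‖ ≤ 2 * (α * T) * (RW * Rx + √m * |σ 0|) := by
  induction T with
  | zero => simp [hidden]
  | succ T ih =>
    set D := RW * Rx + √m * |σ 0|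
    have hD : 0 ≤ D := by positivity
    push_cast at hT ⊢
    have hT' : α * (4 * T * RU) ≤ 1 := by nlinarith [mul_nonneg hα hRU]
    have ih := ih hT' (fun t => X t.castSucc) fun t => hX _
    rw [hidden_succ]
    set h := hidden σ α (1 - α) W U T fun t => X t.castSucc
    have h1 := norm_layer_le hσ W U (X (Fin.last T)) h
    have h2 : frobNorm W * ‖X (Fin.last T)‖ ≤ RW * Rx :=
      mul_le_mul hW (hX _) (norm_nonneg _) hRW
    have h3 : frobNorm U * ‖h‖ ≤ RU * (2 * (α * T) * D) :=
      mul_le_mul hU ih (norm_nonneg _) hRU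
    -- Because αT R_U ≤ 1/4, the recurrent input is no larger than D, so each step adds at most 2αD.
    have h4 : RU * (2 * (α * T) * D) ≤ D := by nlinarith
    refine (norm_add_le _ _).trans ?_
    rw [norm_smul, norm_smul, Real.norm_eq_abs, Real.norm_eq_abs, abs_of_nonneg hα,
      abs_of_nonneg (sub_nonneg.2 hα1)]
    have h5 : α * ‖layer σ W U (X (Fin.last T)) h‖ ≤ α * (2 * D) := by
      gcongr; simp only [D] at h4 ⊢; linarith
    have h6 : (1 - α) * ‖h‖ ≤ 1 * (2 * (α * T) * D) := by
      gcongr; linarith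
    linarith

/-- Induction on A_{T+1} ≤ q A_T + 2καD√n with q = 1 + ακR_U; the a priori bound on ‖h_T‖ keeps the
term R_U H of the layer estimate below D. -/
theorem signAvg_iSup_hidden_le_pow (hσ : LipschitzWith 1 σ) {κ : ℝ} (hκ : 0 ≤ κ)
    (hκσ : IsLayerConst σ m κ) (hRW : 0 ≤ RW) (hRU : 0 ≤ RU) (hRx : 0 ≤ Rx)
    (hα : 0 ≤ α) (hα1 : α ≤ 1) {Θ : Type} [Nonempty Θ] {W : Θ → Matrix (Fin m) (Fin d) ℝ}
    {U : Θ → Matrix (Fin m) (Fin m) ℝ} (hW : ∀ θ, frobNorm (W θ) ≤ RW)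
    (hU : ∀ θ, frobNorm (U θ) ≤ RU) (T : ℕ) (hT : α * (4 * T * RU) ≤ 1)
    (X : Fin n → Fin T → EuclideanSpace ℝ (Fin d)) (hX : ∀ k t, ‖X k t‖ ≤ Rx) :
    signAvg (fun ε => ⨆ θ, ‖signSum ε fun k => hidden σ α (1 - α) (W θ) (U θ) T (X k)‖) ≤
      2 * κ * ((RW * Rx + √m * |σ 0|) * √n) * (α * T) * (1 + α * κ * RU) ^ T := by
  induction T with
  | zero => simp [hidden, signSum_zero, signAvg_const]
  | succ T ih =>
    set D := RW * Rx + √m * |σ 0|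
    have hD : 0 ≤ D := by positivity
    push_cast at hT ⊢
    have hT' : α * (4 * T * RU) ≤ 1 := by nlinarith [mul_nonneg hα hRU]
    have ih := ih hT' (fun k t => X k t.castSucc) fun k t => hX _ _
    set h : Θ → Fin n → EuclideanSpace ℝ (Fin m) := fun θ k =>
      hidden σ α (1 - α) (W θ) (U θ) T fun t => X k t.castSucc
    have hh : ∀ θ k, ‖h θ k‖ ≤ 2 * (α * T) * D := fun θ k =>
      norm_hidden_le hσ hRW hRU hRx hα hα1 (hW θ) (hU θ) T hT' _ fun t => hX _ _
    have hl : ∀ θ k, ‖layer σ (W θ) (U θ) (X k (Fin.last T)) (h θ k)‖ ≤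
        RW * Rx + RU * (2 * (α * T) * D) + √m * |σ 0| := fun θ k => by
      refine (norm_layer_le hσ _ _ _ _).trans ?_
      gcongr
      exacts [hW θ, hX _ _, hU θ, hh θ k]
    have hL := hκσ d n Θ RW RU Rx (2 * (α * T) * D) hRW hRU hRx (by positivity)
      (fun k => X k (Fin.last T)) h W U (fun k => hX _ _) hh hW hU
    set A := signAvg fun ε => ⨆ θ, ‖signSum ε (h θ)‖
    have hA : 0 ≤ A := signAvg_nonneg fun ε => Real.iSup_nonneg fun θ => norm_nonneg _
    have h1 : signAvg (fun ε => ⨆ θ, ‖signSum ε fun k =>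
        hidden σ α (1 - α) (W θ) (U θ) (T + 1) (X k)‖) ≤
        α * signAvg (fun ε => ⨆ θ, ‖signSum ε fun k =>
          layer σ (W θ) (U θ) (X k (Fin.last T)) (h θ k)‖) + (1 - α) * A := by
      rw [← signAvg_const_mul, ← signAvg_const_mul, ← signAvg_add]
      refine signAvg_mono fun ε => ciSup_le fun θ => ?_
      have e : (fun k => hidden σ α (1 - α) (W θ) (U θ) (T + 1) (X k)) = fun k =>
        α • layer σ (W θ) (U θ) (X k (Fin.last T)) (h θ k) + (1 - α) • h θ k := rfl
      rw [e, signSum_add, signSum_smul, signSum_smul]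
      refine (norm_add_le _ _).trans ?_
      rw [norm_smul, norm_smul, Real.norm_eq_abs, Real.norm_eq_abs, abs_of_nonneg hα,
        abs_of_nonneg (sub_nonneg.2 hα1)]
      exact add_le_add
        (mul_le_mul_of_nonneg_left (le_ciSup (bddAbove_norm_signSum hl ε) θ) hα)
        (mul_le_mul_of_nonneg_left (le_ciSup (bddAbove_norm_signSum hh ε) θ) (by linarith))
    have h4 : RU * (2 * (α * T) * D) * √n ≤ D * √n :=
      mul_le_mul_of_nonneg_right (by nlinarith) (Real.sqrt_nonneg _)
    have h5 := mul_le_mul_of_nonneg_left hL hα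
    have h6 : α * (κ * (D * √n + RU * (2 * (α * T) * D) * √n + RU * A)) ≤
        α * (κ * (D * √n + D * √n + RU * A)) := by gcongr
    set q := 1 + α * κ * RU
    have hq : 1 ≤ q := le_add_of_nonneg_right (by positivity)
    have h7 : signAvg (fun ε => ⨆ θ, ‖signSum ε fun k =>
        hidden σ α (1 - α) (W θ) (U θ) (T + 1) (X k)‖) ≤
        q * A + 2 * κ * (D * √n) * α * 1 := by
      have : 0 ≤ α * A := by positivity
      simp only [q]; linarith
    have hqT : 1 ≤ q ^ (T + 1) := one_le_pow₀ hq
    calc _ ≤ q * A + 2 * κ * (D * √n) * α * 1 := h7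
      _ ≤ q * (2 * κ * (D * √n) * (α * T) * q ^ T) + 2 * κ * (D * √n) * α * q ^ (T + 1) := by
          gcongr
      _ = _ := by ring

/-- The complexity of the hidden states after `T` steps is linear in `α T`. -/
theorem signAvg_iSup_hidden_le (hσ : LipschitzWith 1 σ) {κ : ℝ} (hκ : 0 ≤ κ)
    (hκσ : IsLayerConst σ m κ) (hRW : 0 ≤ RW) (hRU : 0 ≤ RU) (hRx : 0 ≤ Rx)
    (hα : 0 ≤ α) (hα1 : α ≤ 1) {Θ : Type} [Nonempty Θ] {W : Θ → Matrix (Fin m) (Fin d) ℝ}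
    {U : Θ → Matrix (Fin m) (Fin m) ℝ} (hW : ∀ θ, frobNorm (W θ) ≤ RW)
    (hU : ∀ θ, frobNorm (U θ) ≤ RU) (T : ℕ) (hT : α * (4 * T * RU) ≤ 1)
    (X : Fin n → Fin T → EuclideanSpace ℝ (Fin d)) (hX : ∀ k t, ‖X k t‖ ≤ Rx) :
    signAvg (fun ε => ⨆ θ, ‖signSum ε fun k => hidden σ α (1 - α) (W θ) (U θ) T (X k)‖) ≤
      2 * κ * Real.exp (κ / 4) * ((RW * Rx + √m * |σ 0|) * (α * T)) * √n := by
  refine (signAvg_iSup_hidden_le_pow hσ hκ hκσ hRW hRU hRx hα hα1 hW hU T hT X hX).trans ?_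
  have h1 : (1 + α * κ * RU) ^ T ≤ Real.exp (κ / 4) := by
    calc (1 + α * κ * RU) ^ T ≤ Real.exp (α * κ * RU) ^ T := by
          gcongr; rw [add_comm]; exact Real.add_one_le_exp _
      _ = Real.exp (T * (α * κ * RU)) := (Real.exp_nat_mul _ _).symm
      -- Here αT R_U ≤ 1/4 enters again.
      _ ≤ Real.exp (κ / 4) := Real.exp_le_exp.2 (by nlinarith)
  calc _ ≤ 2 * κ * ((RW * Rx + √m * |σ 0|) * √n) * (α * T) * Real.exp (κ / 4) := by gcongr
    _ = _ := by ring

theorem exists_isLayerConst (hσ : LipschitzWith 1 σ) :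
    ∃ κ : ℕ → ℝ, (∀ m, 0 ≤ κ m) ∧ (∀ m, IsLayerConst σ m (κ m)) ∧
      (BoundedVariationOn (deriv σ) Set.univ → ∀ m m', κ m = κ m') := by
  by_cases hbv : BoundedVariationOn (deriv σ) Set.univ
  · obtain ⟨K, hK, hramp⟩ := exists_ramp_bound hσ hbv
    exact ⟨fun _ => 12 * K + 1, fun _ => by positivity, isLayerConst_of_ramp_bound hK hramp,
      fun _ _ _ => rfl⟩
  · exact ⟨fun m => 2 * √m + 1, fun _ => by positivity, isLayerConst_of_lipschitzWith hσ,
      fun h => absurd h hbv⟩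

end hidden
-- McDiarmid's inequality.
section boundedDifferences
variable {Ω : Type*} [MeasurableSpace Ω]

theorem integrable_of_abs_le {X : Type*} [MeasurableSpace X] {μ : Measure X} [IsFiniteMeasure μ]
    {f : X → ℝ} (hf : Measurable f) {M : ℝ} (hM : ∀ x, |f x| ≤ M) : Integrable f μ :=
  Integrable.of_bound hf.aestronglyMeasurable M (Filter.Eventually.of_forall hM)

theorem abs_integral_le_of_abs_le {X : Type*} [MeasurableSpace X] {μ : Measure X}
    [IsProbabilityMeasure μ] {f : X → ℝ} {M : ℝ} (hM : ∀ x, |f x| ≤ M) : |∫ x, f x ∂μ| ≤ M := by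
  simpa using norm_integral_le_of_norm_le_const (μ := μ) (f := f)
    (Filter.Eventually.of_forall hM)

/-- Hoeffding's lemma, on the interval of length `c` starting at the infimum of `X`. -/
theorem integral_exp_mul_sub_integral_le {P : Measure Ω} [IsProbabilityMeasure P] {X : Ω → ℝ}
    (hX : Measurable X) {c : ℝ} (hc : 0 ≤ c) (h : ∀ a b, |X a - X b| ≤ c) (t : ℝ) :
    ∫ a, Real.exp (t * (X a - ∫ b, X b ∂P)) ∂P ≤ Real.exp ((c / 2) ^ 2 * t ^ 2 / 2) := by
  have : Nonempty Ω := nonempty_of_isProbabilityMeasure P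
  have hbdd : BddBelow (Set.range X) := ⟨X (Classical.arbitrary Ω) - c, by
    rintro _ ⟨a, rfl⟩; linarith [(abs_le.1 (h (Classical.arbitrary Ω) a)).2]⟩
  have hmem : ∀ a, X a ∈ Set.Icc (⨅ b, X b) ((⨅ b, X b) + c) := fun a =>
    ⟨ciInf_le hbdd a, by
      have : X a - c ≤ ⨅ b, X b := le_ciInf fun b => by linarith [(abs_le.1 (h a b)).2]
      linarith⟩
  have h1 := (ProbabilityTheory.hasSubgaussianMGF_of_mem_Icc (μ := P) hX.aemeasurable
    (Filter.Eventually.of_forall hmem)).mgf_le t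
  simpa [ProbabilityTheory.mgf, abs_of_nonneg hc] using h1

/-- The exponential moment bound behind McDiarmid's inequality. -/
theorem integral_exp_le_of_bounded_differences (P : Measure Ω) [IsProbabilityMeasure P]
    {c M : ℝ} (hc : 0 ≤ c) (t : ℝ) (n : ℕ) {f : (Fin n → Ω) → ℝ} (hf : Measurable f)
    (hM : ∀ x, |f x| ≤ M) (hd : ∀ x i a, |f (Function.update x i a) - f x| ≤ c) :
    ∫ x, Real.exp (t * (f x - ∫ y, f y ∂Measure.pi fun _ => P)) ∂(Measure.pi fun _ => P) ≤
      Real.exp (n * (c / 2) ^ 2 * t ^ 2 / 2) := by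
  induction n with
  | zero =>
    have h1 : ∀ x, f x = f default := fun x => congrArg f (Subsingleton.elim _ _)
    simp [h1]
  | succ n ih =>
    set G : Ω × (Fin n → Ω) → ℝ := fun p => f (Fin.cons p.1 p.2)
    have hcons : Measurable fun p : Ω × (Fin n → Ω) => (Fin.cons p.1 p.2 : Fin (n + 1) → Ω) := by
      refine measurable_pi_iff.2 fun i => ?_
      refine Fin.cases ?_ (fun j => ?_) i
      · simpa using measurable_fst
      · simpa using (by fun_prop : Measurable fun p : Ω × (Fin n → Ω) => p.2 j)
    have hG : Measurable G := hf.comp hcons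
    have hGM : ∀ p, |G p| ≤ M := fun p => hM _
    have hmp := (measurePreserving_piFinSuccAbove (fun _ : Fin (n + 1) => P) 0).symm
    have hint : ∀ g : (Fin (n + 1) → Ω) → ℝ, ∫ x, g x ∂(Measure.pi fun _ => P) =
        ∫ p, g (Fin.cons p.1 p.2) ∂(P.prod (Measure.pi fun _ => P)) := fun g => by
      rw [← hmp.integral_comp' g]
      refine integral_congr_ae (Filter.Eventually.of_forall fun p => ?_)
      simp [MeasurableEquiv.piFinSuccAbove, Fin.insertNthEquiv, Fin.insertNth_zero']
    -- Averaging out the first coordinate preserves bounded differences, so the induction hypothesis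
    -- applies to `F`; Hoeffding's lemma handles f − F for fixed remaining coordinates.
    set F : (Fin n → Ω) → ℝ := fun x => ∫ a, G (a, x) ∂P
    have hF : Measurable F := hG.stronglyMeasurable.integral_prod_left'.measurable
    have hFM : ∀ x, |F x| ≤ M := fun x => abs_integral_le_of_abs_le fun a => hGM _
    have hGx : ∀ x, Measurable fun a => G (a, x) := fun x => hG.comp measurable_prodMk_right
    have hFd : ∀ x i b, |F (Function.update x i b) - F x| ≤ c := fun x i b => by
      simp only [F]
      rw [← integral_sub (integrable_of_abs_le (hGx _) fun a => hGM _)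
        (integrable_of_abs_le (hGx _) fun a => hGM _)]
      refine abs_integral_le_of_abs_le fun a => ?_
      simp only [G, Fin.cons_update]
      exact hd _ _ _
    set E := ∫ y, F y ∂(Measure.pi fun _ => P)
    have hE : ∫ y, f y ∂(Measure.pi fun _ => P) = E := by
      rw [hint f, integral_prod_symm _ (integrable_of_abs_le hG hGM)]
    have ih := ih hF hFM hFd
    have hEM : |E| ≤ M := abs_integral_le_of_abs_le hFM
    have hexp : ∀ u v : ℝ, |u| ≤ M → |v| ≤ M →
        |Real.exp (t * (u - v))| ≤ Real.exp (|t| * (M + M)) := fun u v hu hv => by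
      rw [Real.abs_exp]
      refine Real.exp_le_exp.2 ((le_abs_self _).trans ?_)
      rw [abs_mul]
      exact mul_le_mul_of_nonneg_left ((abs_sub _ _).trans (add_le_add hu hv)) (abs_nonneg _)
    have hmeas : Measurable fun p : Ω × (Fin n → Ω) => Real.exp (t * (G p - E)) :=
      Real.measurable_exp.comp ((hG.sub_const _).const_mul _)
    rw [hE, hint, integral_prod_symm (fun p => Real.exp (t * (G p - E)))
      (integrable_of_abs_le hmeas fun p => hexp _ _ (hGM p) hEM)]
    have hinner : ∀ x, ∫ a, Real.exp (t * (G (a, x) - E)) ∂P ≤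
        Real.exp (t * (F x - E)) * Real.exp ((c / 2) ^ 2 * t ^ 2 / 2) := fun x => by
      have h1 : ∀ a, Real.exp (t * (G (a, x) - E)) =
          Real.exp (t * (F x - E)) * Real.exp (t * (G (a, x) - F x)) := fun a => by
        rw [← Real.exp_add]; ring_nf
      simp only [h1]
      rw [integral_const_mul]
      refine mul_le_mul_of_nonneg_left ?_ (Real.exp_nonneg _)
      refine integral_exp_mul_sub_integral_le (hGx x) hc (fun a b => ?_) t
      have h2 := hd (Fin.cons b x) 0 a
      rwa [Fin.update_cons_zero] at h2
    calc ∫ x, ∫ a, Real.exp (t * (G (a, x) - E)) ∂P ∂(Measure.pi fun _ => P)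
        ≤ ∫ x, Real.exp (t * (F x - E)) * Real.exp ((c / 2) ^ 2 * t ^ 2 / 2)
            ∂(Measure.pi fun _ => P) := by
          refine integral_mono ?_ ?_ hinner
          · exact integrable_of_abs_le hmeas.stronglyMeasurable.integral_prod_left'.measurable
              fun x => abs_integral_le_of_abs_le fun a => hexp _ _ (hGM (a, x)) hEM
          · exact (integrable_of_abs_le (Real.measurable_exp.comp ((hF.sub_const _).const_mul _))
              fun x => hexp _ _ (hFM x) hEM).mul_const _
      _ ≤ Real.exp (n * (c / 2) ^ 2 * t ^ 2 / 2) * Real.exp ((c / 2) ^ 2 * t ^ 2 / 2) := by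
          rw [integral_mul_const]
          exact mul_le_mul_of_nonneg_right ih (Real.exp_nonneg _)
      _ = _ := by
          rw [← Real.exp_add]; push_cast; ring_nf

/-- McDiarmid's inequality with a common bound for the differences. -/
theorem measureReal_le_of_bounded_differences (P : Measure Ω) [IsProbabilityMeasure P]
    {c M : ℝ} (hc : 0 ≤ c) (n : ℕ) {f : (Fin n → Ω) → ℝ} (hf : Measurable f)
    (hM : ∀ x, |f x| ≤ M) (hd : ∀ x i a, |f (Function.update x i a) - f x| ≤ c)
    {s : ℝ} (hs : 0 ≤ s) :
    (Measure.pi fun _ => P).real {x | s ≤ f x - ∫ y, f y ∂(Measure.pi fun _ => P)} ≤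
      Real.exp (-s ^ 2 / (2 * (n * (c / 2) ^ 2))) := by
  have hE : |∫ y, f y ∂(Measure.pi fun _ : Fin n => P)| ≤ M := abs_integral_le_of_abs_le hM
  have h : ProbabilityTheory.HasSubgaussianMGF
      (fun x => f x - ∫ y, f y ∂(Measure.pi fun _ : Fin n => P))
      (n * (c / 2).toNNReal ^ 2) (Measure.pi fun _ => P) := by
    refine ⟨fun t => ?_, fun t => ?_⟩
    · refine integrable_of_abs_le (M := Real.exp (|t| * (M + M)))
        (Real.measurable_exp.comp ((hf.sub_const _).const_mul _)) fun x => ?_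
      rw [Real.abs_exp]
      refine Real.exp_le_exp.2 ((le_abs_self _).trans ?_)
      rw [abs_mul]
      exact mul_le_mul_of_nonneg_left ((abs_sub _ _).trans (add_le_add (hM x) hE)) (abs_nonneg _)
    · have h1 := integral_exp_le_of_bounded_differences P hc t n hf hM hd
      simpa [ProbabilityTheory.mgf, Real.coe_toNNReal _ (div_nonneg hc zero_le_two)] using h1
  simpa [Real.coe_toNNReal _ (div_nonneg hc zero_le_two)] using h.measure_ge_le hs

end boundedDifferences

/-! ### Symmetrization and deviation for finite classes. -/

section symmetrization
variable {Ω : Type*} {n : ℕ} {ι : Type*} {g : ι → Ω → ℝ} {B : ℝ}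

theorem abs_iSup_le_of_abs_le {κ : Type*} [Nonempty κ] {a : κ → ℝ} {M : ℝ} (h : ∀ i, |a i| ≤ M) :
    |⨆ i, a i| ≤ M := by
  have hb : BddAbove (Set.range a) := ⟨M, by rintro _ ⟨i, rfl⟩; exact (abs_le.1 (h i)).2⟩
  exact abs_le.2 ⟨(abs_le.1 (h (Classical.arbitrary κ))).1.trans (le_ciSup hb _),
    ciSup_le fun i => (abs_le.1 (h i)).2⟩

theorem measurable_signSum {X : Type*} [MeasurableSpace X] (ε : Fin n → ℤˣ) {a : X → Fin n → ℝ}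
    (ha : ∀ k, Measurable fun x => a x k) : Measurable fun x => signSum ε (a x) :=
  Finset.measurable_sum _ fun k _ => (ha k).const_mul _

/-- Exchanging the two members of the pairs with a negative sign. -/
def swapSigns (ε : Fin n → ℤˣ) (Z : Fin n → Ω × Ω) : Fin n → Ω × Ω :=
  fun k => (if ε k = 1 then id else Prod.swap) (Z k)

theorem measurePreserving_swapSigns [MeasurableSpace Ω] (P : Measure Ω)
    [IsProbabilityMeasure P] (ε : Fin n → ℤˣ) :
    MeasurePreserving (swapSigns ε) (Measure.pi fun _ : Fin n => P.prod P)
      (Measure.pi fun _ => P.prod P) := by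
  refine measurePreserving_pi (fun _ => P.prod P) (fun _ => P.prod P) fun k => ?_
  split_ifs
  · exact MeasurePreserving.id _
  · exact Measure.measurePreserving_swap

theorem sum_swapSigns (ε : Fin n → ℤˣ) (Z : Fin n → Ω × Ω) (f : Ω → ℝ) :
    ∑ k, (f (swapSigns ε Z k).2 - f (swapSigns ε Z k).1) =
      signSum ε fun k => f (Z k).2 - f (Z k).1 := by
  refine Finset.sum_congr rfl fun k _ => ?_
  rcases Int.units_eq_one_or (ε k) with h | h <;> simp [swapSigns, h]

theorem signAvg_integral {X : Type*} [MeasurableSpace X] {μ : Measure X}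
    {F : (Fin n → ℤˣ) → X → ℝ} (hF : ∀ ε, Integrable (F ε) μ) :
    signAvg (fun ε => ∫ x, F ε x ∂μ) = ∫ x, signAvg (fun ε => F ε x) ∂μ := by
  simp only [signAvg]
  rw [integral_div, integral_finsetSum _ fun ε _ => hF ε]

/-- The largest gap between expectation and sample sum over a class. -/
noncomputable def maxGap [MeasurableSpace Ω] (P : Measure Ω) (g : ι → Ω → ℝ) (S : Fin n → Ω) : ℝ :=
  ⨆ i, (n * ∫ ω, g i ω ∂P - ∑ k, g i (S k))

theorem measurable_maxGap [MeasurableSpace Ω] [Finite ι] (P : Measure Ω)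
    (hg : ∀ i, Measurable (g i)) :
    Measurable (maxGap (n := n) P g) :=
  Measurable.iSup fun i => measurable_const.sub
    (Finset.measurable_sum _ fun k _ => (hg i).comp (measurable_pi_apply k))

theorem abs_maxGap_le [MeasurableSpace Ω] [Nonempty ι] (P : Measure Ω)
    [IsProbabilityMeasure P] (hB : ∀ i ω, |g i ω| ≤ B)
    (S : Fin n → Ω) : |maxGap P g S| ≤ n * B + n * B := by
  refine abs_iSup_le_of_abs_le fun i => (abs_sub _ _).trans (add_le_add ?_ ?_)
  · rw [abs_mul, Nat.abs_cast]
    exact mul_le_mul_of_nonneg_left (abs_integral_le_of_abs_le (hB i)) (Nat.cast_nonneg n)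
  · refine (Finset.abs_sum_le_sum_abs _ _).trans ?_
    calc ∑ k, |g i (S k)| ≤ ∑ _k : Fin n, B := Finset.sum_le_sum fun k _ => hB i _
      _ = n * B := by simp

theorem maxGap_update_le [MeasurableSpace Ω] [Finite ι] [Nonempty ι] (P : Measure Ω)
    (hd : ∀ i ω ω', |g i ω - g i ω'| ≤ B)
    (S : Fin n → Ω) (j : Fin n) (a : Ω) :
    |maxGap P g (Function.update S j a) - maxGap P g S| ≤ B := by
  have key : ∀ S S' : Fin n → Ω, (∀ k, k ≠ j → S' k = S k) → maxGap P g S' ≤ maxGap P g S + B := by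
    intro S S' h
    refine ciSup_le fun i => ?_
    have h1 : n * ∫ ω, g i ω ∂P - ∑ k, g i (S k) ≤ maxGap P g S :=
      le_ciSup (f := fun i => n * ∫ ω, g i ω ∂P - ∑ k, g i (S k)) (Set.finite_range _).bddAbove i
    have h2 : ∑ k, g i (S k) - ∑ k, g i (S' k) = g i (S j) - g i (S' j) := by
      rw [← Finset.sum_sub_distrib]
      refine Finset.sum_eq_single j (fun k _ hk => by rw [h k hk, sub_self]) (by simp)
    have h3 := (abs_le.1 (hd i (S j) (S' j))).2
    linarith
  have h1 := key S (Function.update S j a) fun k hk => Function.update_of_ne hk _ _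
  have h2 := key (Function.update S j a) S fun k hk => (Function.update_of_ne hk _ _).symm
  exact abs_le.2 ⟨by linarith, by linarith⟩

/-- Symmetrization: the expected gap is at most twice the Rademacher complexity. -/
theorem integral_maxGap_le [MeasurableSpace Ω] [Finite ι] [Nonempty ι] (P : Measure Ω)
    [IsProbabilityMeasure P] (hg : ∀ i, Measurable (g i))
    (hB : ∀ i ω, |g i ω| ≤ B) {r : ℝ}
    (hr : ∀ᵐ S ∂(Measure.pi fun _ : Fin n => P), rad (fun i k => g i (S k)) ≤ r) :
    ∫ S, maxGap P g S ∂(Measure.pi fun _ : Fin n => P) ≤ 2 * r := by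
  set μ := Measure.pi fun _ : Fin n => P
  set ν := Measure.pi fun _ : Fin n => P.prod P
  set D : (Fin n → Ω × Ω) → ι → Fin n → ℝ := fun Z i k => g i (Z k).2 - g i (Z k).1
  have hDB : ∀ Z i k, |D Z i k| ≤ B + B := fun Z i k =>
    (abs_sub _ _).trans (add_le_add (hB i _) (hB i _))
  have hDm : ∀ i k, Measurable fun Z => D Z i k := fun i k =>
    ((hg i).comp (measurable_snd.comp (measurable_pi_apply k))).sub
      ((hg i).comp (measurable_fst.comp (measurable_pi_apply k)))
  have hΨm : ∀ ε : Fin n → ℤˣ, Measurable fun Z => ⨆ i, signSum ε (D Z i) := fun ε =>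
    Measurable.iSup fun i => measurable_signSum ε (hDm i)
  have hΨM : ∀ (ε : Fin n → ℤˣ) Z, |⨆ i, signSum ε (D Z i)| ≤ n * (B + B) := fun ε Z =>
    abs_iSup_le_of_abs_le fun i => norm_signSum_le (E := ℝ) ε (hDB Z i)
  have hΨi : ∀ ε : Fin n → ℤˣ, Integrable (fun Z => ⨆ i, signSum ε (D Z i)) ν := fun ε =>
    integrable_of_abs_le (hΨm ε) (hΨM ε)
  have hone : ∀ a : Fin n → ℝ, signSum 1 a = ∑ k, a k := fun a => by simp [signSum]
  -- comparison with an independent copy of the sample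
  have hghost : ∫ S, maxGap P g S ∂μ ≤ ∫ Z, ⨆ i, signSum 1 (D Z i) ∂ν := by
    have hmp := (measurePreserving_arrowProdEquivProdArrow Ω Ω (Fin n) (fun _ => P)
      (fun _ => P)).symm
    have hpair : Measurable fun q : (Fin n → Ω) × (Fin n → Ω) => fun k => (q.1 k, q.2 k) :=
      measurable_pi_iff.2 fun k => ((measurable_pi_apply k).comp measurable_fst).prodMk
        ((measurable_pi_apply k).comp measurable_snd)
    have hcm : Measurable fun q : (Fin n → Ω) × (Fin n → Ω) =>
        ⨆ i, signSum 1 (D (fun k => (q.1 k, q.2 k)) i) := (hΨm 1).comp hpair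
    have e1 : ∫ Z, ⨆ i, signSum 1 (D Z i) ∂ν =
        ∫ q : (Fin n → Ω) × (Fin n → Ω), ⨆ i, signSum 1 (D (fun k => (q.1 k, q.2 k)) i)
          ∂(μ.prod μ) := by
      rw [← hmp.integral_comp' fun Z => ⨆ i, signSum 1 (D Z i)]
      rfl
    rw [e1, integral_prod _ (integrable_of_abs_le hcm fun q => hΨM 1 _)]
    refine integral_mono (integrable_of_abs_le (measurable_maxGap P hg) (abs_maxGap_le P hB))
      (integrable_of_abs_le hcm.stronglyMeasurable.integral_prod_right'.measurable
        fun S => abs_integral_le_of_abs_le fun S' => hΨM 1 fun k => (S k, S' k)) fun S => ?_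
    refine ciSup_le fun i => ?_
    have hgk : ∀ k, Integrable (fun S' : Fin n → Ω => g i (S' k)) μ := fun k =>
      integrable_of_abs_le ((hg i).comp (measurable_pi_apply k)) fun _ => hB i _
    have hmarg : ∀ k, ∫ S', g i (S' k) ∂μ = ∫ ω, g i ω ∂P := fun k => by
      have h1 := measurePreserving_eval (fun _ : Fin n => P) k
      rw [← h1.map_eq, integral_map h1.measurable.aemeasurable (hg i).aestronglyMeasurable]
    have e2 : n * ∫ ω, g i ω ∂P - ∑ k, g i (S k) =
        ∫ S', signSum 1 (D (fun k => (S k, S' k)) i) ∂μ := by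
      simp only [hone, D]
      have hsub : ∀ k, Integrable (fun S' : Fin n → Ω => g i (S' k) - g i (S k)) μ := fun k =>
        (hgk k).sub (integrable_const _)
      rw [integral_finsetSum _ fun k _ => hsub k]
      simp only [integral_sub (hgk _) (integrable_const _), hmarg, integral_const,
        Finset.sum_sub_distrib]
      simp
    rw [e2]
    refine integral_mono ?_ ?_ fun S' =>
      le_ciSup (f := fun i => signSum 1 (D (fun k => (S k, S' k)) i))
        (Set.finite_range _).bddAbove i
    · exact integrable_of_abs_le
        ((measurable_signSum 1 (hDm i)).comp (hpair.comp measurable_prodMk_left)) fun S' =>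
          norm_signSum_le (E := ℝ) 1 (hDB (fun k => (S k, S' k)) i)
    · exact integrable_of_abs_le (hcm.comp measurable_prodMk_left) fun S' => hΨM 1 _
  -- The members of each pair are independent and identically distributed, so exchanging them where
  -- ε is −1 preserves the law.
  have hswap : ∀ ε : Fin n → ℤˣ, ∫ Z, ⨆ i, signSum ε (D Z i) ∂ν =
      ∫ Z, ⨆ i, signSum 1 (D Z i) ∂ν := by
    intro ε
    have h1 : MeasurePreserving (swapSigns ε) ν ν := measurePreserving_swapSigns P ε
    conv_rhs => rw [← h1.map_eq]
    rw [integral_map h1.measurable.aemeasurable (hΨm 1).aestronglyMeasurable]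
    refine integral_congr_ae (Filter.Eventually.of_forall fun Z => ?_)
    simp only [hone, D, sum_swapSigns]
  have havg : ∫ Z, ⨆ i, signSum 1 (D Z i) ∂ν =
      ∫ Z, signAvg (fun ε => ⨆ i, signSum ε (D Z i)) ∂ν := by
    rw [← signAvg_integral hΨi]
    simp only [hswap, signAvg_const]
  have hfst : MeasurePreserving (fun (Z : Fin n → Ω × Ω) k => (Z k).1) ν μ :=
    measurePreserving_pi _ _ fun _ => measurePreserving_fst
  have hsnd : MeasurePreserving (fun (Z : Fin n → Ω × Ω) k => (Z k).2) ν μ :=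
    measurePreserving_pi _ _ fun _ => measurePreserving_snd
  refine hghost.trans ?_
  rw [havg]
  have hbound : ∀ᵐ Z ∂ν, signAvg (fun ε => ⨆ i, signSum ε (D Z i)) ≤ 2 * r := by
    filter_upwards [hfst.quasiMeasurePreserving.ae hr, hsnd.quasiMeasurePreserving.ae hr]
      with Z h1 h2
    refine le_trans ?_ (two_mul r ▸ add_le_add h2 h1)
    unfold rad
    rw [← signAvg_neg fun ε => ⨆ i, signSum ε fun k => g i (Z k).1, ← signAvg_add]
    refine signAvg_mono fun ε => ciSup_le fun i => ?_
    simp only [D]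
    rw [signSum_sub, sub_eq_add_neg, ← signSum_neg]
    exact add_le_add
      (le_ciSup (f := fun i => signSum ε fun k => g i (Z k).2) (Set.finite_range _).bddAbove i)
      (le_ciSup (f := fun i => signSum (-ε) fun k => g i (Z k).1) (Set.finite_range _).bddAbove i)
  have hi : Integrable (fun Z => signAvg fun ε => ⨆ i, signSum ε (D Z i)) ν := by
    simp only [signAvg]
    exact (integrable_finsetSum _ fun ε _ => hΨi ε).div_const _
  simpa using integral_mono_ae hi (integrable_const (2 * r)) hbound

/-- The uniform deviation bound for a finite class, in terms of its Rademacher complexity. -/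
theorem measure_exists_gap_le [MeasurableSpace Ω] [Finite ι] [Nonempty ι] (P : Measure Ω)
    [IsProbabilityMeasure P] (hn : 0 < n)
    (hB : 0 < B) (hg : ∀ i, Measurable (g i)) (hg0 : ∀ i ω, 0 ≤ g i ω) (hgB : ∀ i ω, g i ω ≤ B)
    {r : ℝ} (hr : ∀ᵐ S ∂(Measure.pi fun _ : Fin n => P), rad (fun i k => g i (S k)) ≤ r)
    {δ : ℝ} (hδ : 0 < δ) (hδ1 : δ ≤ 1) :
    (Measure.pi fun _ : Fin n => P) {S | ∃ i, (1 / n) * ∑ k, g i (S k) + 2 * r / n +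
      B * √(Real.log (1 / δ) / n) < ∫ ω, g i ω ∂P} ≤ ENNReal.ofReal δ := by
  have hn' : (0 : ℝ) < n := Nat.cast_pos.2 hn
  have hgabs : ∀ i ω, |g i ω| ≤ B := fun i ω => abs_le.2 ⟨by linarith [hg0 i ω], hgB i ω⟩
  have hlog : 0 ≤ Real.log (1 / δ) := Real.log_nonneg (by rw [le_div_iff₀ hδ]; linarith)
  set s := n * (B * √(Real.log (1 / δ) / n))
  have hs : 0 ≤ s := by positivity
  have h1 := measureReal_le_of_bounded_differences P hB.le n (measurable_maxGap P hg)
    (abs_maxGap_le P hgabs) (maxGap_update_le P fun i ω ω' => abs_le.2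
      ⟨by linarith [hg0 i ω, hgB i ω'], by linarith [hg0 i ω', hgB i ω]⟩) hs
  have hE := integral_maxGap_le P hg hgabs hr
  -- The exponent equals −2 log(1/δ), so the probability is at most δ² ≤ δ.
  have hexp : Real.exp (-s ^ 2 / (2 * (n * (B / 2) ^ 2))) ≤ δ := by
    have e : -s ^ 2 / (2 * (n * (B / 2) ^ 2)) = -(2 * Real.log (1 / δ)) := by
      simp only [s]
      rw [mul_pow, mul_pow, Real.sq_sqrt (by positivity)]
      field_simp
    rw [e, ← Real.exp_log hδ]
    refine Real.exp_le_exp.2 ?_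
    rw [Real.exp_log hδ]
    rw [one_div, Real.log_inv] at hlog ⊢
    linarith
  rw [← ENNReal.ofReal_toReal (measure_ne_top (Measure.pi fun _ : Fin n => P) _)]
  refine ENNReal.ofReal_le_ofReal ((measureReal_mono ?_ (measure_ne_top _ _)).trans
    (h1.trans hexp))
  rintro S ⟨i, hi⟩
  have h2 : n * ∫ ω, g i ω ∂P - ∑ k, g i (S k) ≤ maxGap P g S :=
    le_ciSup (f := fun i => n * ∫ ω, g i ω ∂P - ∑ k, g i (S k)) (Set.finite_range _).bddAbove i
  have h3 : n * ((1 / n) * ∑ k, g i (S k) + 2 * r / n + B * √(Real.log (1 / δ) / n)) <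
      n * ∫ ω, g i ω ∂P := mul_lt_mul_of_pos_left hi hn'
  have h4 : n * ((1 / n) * ∑ k, g i (S k) + 2 * r / n + B * √(Real.log (1 / δ) / n)) =
      ∑ k, g i (S k) + 2 * r + s := by
    simp only [s]; field_simp
  simp only [Set.mem_ofPred_eq]
  linarith

end symmetrization
-- From finite to separable classes.
/-- The uniform deviation bound for a class that depends continuously on its parameter, when all
its finite subfamilies have Rademacher complexity at most `r`. -/
theorem measure_exists_gap_le_of_continuous {Ω Θ : Type*} [MeasurableSpace Ω] [TopologicalSpace Θ]
    [SecondCountableTopology Θ] [Nonempty Θ] {g : Θ → Ω → ℝ} {B : ℝ} {n : ℕ}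
    (P : Measure Ω) [IsProbabilityMeasure P] (hn : 0 < n) (hB : 0 ≤ B)
    (hg : ∀ θ, Measurable (g θ)) (hgc : ∀ ω, Continuous fun θ => g θ ω)
    (hg0 : ∀ θ ω, 0 ≤ g θ ω) (hgB : ∀ θ ω, g θ ω ≤ B) {r : ℝ} (hr0 : 0 ≤ r)
    (hr : ∀ (N : ℕ) (u : Fin (N + 1) → Θ), ∀ᵐ S ∂(Measure.pi fun _ : Fin n => P),
      rad (fun i k => g (u i) (S k)) ≤ r)
    {δ : ℝ} (hδ : 0 < δ) (hδ1 : δ ≤ 1) :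
    (Measure.pi fun _ : Fin n => P) {S | ∃ θ, (1 / n) * ∑ k, g θ (S k) + 2 * r / n +
      B * √(Real.log (1 / δ) / n) < ∫ ω, g θ ω ∂P} ≤ ENNReal.ofReal δ := by
  rcases hB.eq_or_lt with rfl | hB
  · have h0 : ∀ θ ω, g θ ω = 0 := fun θ ω => le_antisymm (hgB θ ω) (hg0 θ ω)
    have : ¬ 2 * r / n < 0 := not_lt.2 (by positivity)
    simp [h0, this]
  have hcE : Continuous fun θ => ∫ ω, g θ ω ∂P := by
    refine continuous_of_dominated (bound := fun _ => B)
      (fun θ => (hg θ).aestronglyMeasurable) (fun θ => ?_) (integrable_const B)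
      (Filter.Eventually.of_forall hgc)
    exact Filter.Eventually.of_forall fun ω =>
      (abs_of_nonneg (hg0 θ ω)).le.trans (hgB θ ω)
  set u := TopologicalSpace.denseSeq Θ
  set A : ℕ → Set (Fin n → Ω) := fun N => {S | ∃ i : Fin (N + 1), (1 / n) * ∑ k, g (u i) (S k) +
    2 * r / n + B * √(Real.log (1 / δ) / n) < ∫ ω, g (u i) ω ∂P}
  have hA : ∀ N, (Measure.pi fun _ : Fin n => P) (A N) ≤ ENNReal.ofReal δ := fun N =>
    measure_exists_gap_le P hn hB (fun i => hg _) (fun i => hg0 _) (fun i => hgB _)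
      (hr N fun i => u i) hδ hδ1
  have hmono : Monotone A := by
    rintro N N' h S ⟨i, hi⟩
    exact ⟨⟨i, by omega⟩, hi⟩
  refine (measure_mono (t := ⋃ N, A N) ?_).trans ?_
  · rintro S ⟨θ, hθ⟩
    -- Violation of the bound is an open condition on θ, so a violating θ yields a violating member
    -- of the dense sequence.
    have hopen : IsOpen {θ | (1 / n) * ∑ k, g θ (S k) + 2 * r / n +
        B * √(Real.log (1 / δ) / n) < ∫ ω, g θ ω ∂P} := by
      refine isOpen_lt ?_ hcE
      have : Continuous fun θ => ∑ k, g θ (S k) := continuous_finsetSum _ fun k _ => hgc (S k)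
      fun_prop
    obtain ⟨j, hθ'⟩ := (TopologicalSpace.denseRange_denseSeq Θ).exists_mem_open hopen ⟨θ, hθ⟩
    exact Set.mem_iUnion.2 ⟨j, ⟨j, by omega⟩, hθ'⟩
  · rw [hmono.measure_iUnion]
    exact iSup_le hA

/-! ### Continuity and complexity of the network. -/

section continuity
variable {d m : ℕ} {σ τ : ℝ → ℝ} {Y : Type*} [TopologicalSpace Y]
  {W : Y → Matrix (Fin m) (Fin d) ℝ} {U : Y → Matrix (Fin m) (Fin m) ℝ}

theorem continuous_hidden (hσ : Continuous σ) (α β : ℝ) (hW : Continuous W) (hU : Continuous U)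
    (T : ℕ) {X : Y → Fin T → EuclideanSpace ℝ (Fin d)} (hX : Continuous X) :
    Continuous fun y => hidden σ α β (W y) (U y) T (X y) := by
  induction T with
  | zero => exact continuous_const
  | succ T ih =>
    simp only [hidden_succ]
    have hh := ih (X := fun y t => X y t.castSucc) (by fun_prop)
    refine (Continuous.const_smul ?_ α).add (hh.const_smul β)
    refine (PiLp.continuous_toLp 2 _).comp (continuous_pi fun i => hσ.comp ?_)
    have h1 : Continuous fun y => (W y).mulVec (X y (Fin.last T)).ofLp :=
      hW.matrix_mulVec ((PiLp.continuous_ofLp 2 _).comp (by fun_prop))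
    have h2 : Continuous fun y =>
        (U y).mulVec (hidden σ α β (W y) (U y) T fun t => X y t.castSucc).ofLp :=
      hU.matrix_mulVec ((PiLp.continuous_ofLp 2 _).comp hh)
    exact ((continuous_apply i).comp h1).add ((continuous_apply i).comp h2)

theorem continuous_classifier (hσ : Continuous σ) (hτ : Continuous τ) (α β : ℝ) {T : ℕ}
    (hW : Continuous W) (hU : Continuous U) {v : Y → EuclideanSpace ℝ (Fin m)} (hv : Continuous v)
    {X : Y → Fin T → EuclideanSpace ℝ (Fin d)} (hX : Continuous X) :
    Continuous fun y => classifier σ τ α β (W y) (U y) (v y) (X y) :=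
  hτ.comp (hv.inner (continuous_hidden hσ α β hW hU T hX))

end continuity

/-- The parameters `(W, U, v)` of the classifiers. -/
abbrev Param (d m : ℕ) (RW RU Rv : ℝ) : Type :=
  {p : Matrix (Fin m) (Fin d) ℝ × Matrix (Fin m) (Fin m) ℝ × EuclideanSpace ℝ (Fin m) //
    frobNorm p.1 ≤ RW ∧ frobNorm p.2.1 ≤ RU ∧ ‖p.2.2‖ ≤ Rv}

instance {d m : ℕ} {RW RU Rv : ℝ} : SecondCountableTopology (Param d m RW RU Rv) := by
  have h1 : SecondCountableTopology (Matrix (Fin m) (Fin d) ℝ) :=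
    inferInstanceAs (SecondCountableTopology (Fin m → Fin d → ℝ))
  have h2 : SecondCountableTopology (Matrix (Fin m) (Fin m) ℝ) :=
    inferInstanceAs (SecondCountableTopology (Fin m → Fin m → ℝ))
  exact Topology.IsInducing.subtypeVal.secondCountableTopology

/-- The classifier with parameters `p`. -/
noncomputable def paramClassifier (σ τ : ℝ → ℝ) (α : ℝ) {d m T : ℕ} {RW RU Rv : ℝ}
    (p : Param d m RW RU Rv) : (Fin T → EuclideanSpace ℝ (Fin d)) → ℝ :=
  classifier σ τ α (1 - α) p.1.1 p.1.2.1 p.1.2.2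

section complexity
variable {d m T n : ℕ} {σ τ : ℝ → ℝ} {RW RU Rx Rv α κ B : ℝ}

/-- The Rademacher complexity of the losses of finitely many classifiers. -/
theorem rad_loss_le (hσ : LipschitzWith 1 σ) (hτ : LipschitzWith 1 τ) (hκ : 0 ≤ κ)
    (hκσ : IsLayerConst σ m κ) (hRW : 0 ≤ RW) (hRU : 0 ≤ RU) (hRx : 0 ≤ Rx) (hRv : 0 ≤ Rv)
    (hα : 0 ≤ α) (hα1 : α ≤ 1) (hT : α * (4 * T * RU) ≤ 1) {ι : Type} [Nonempty ι]
    (u : ι → Param d m RW RU Rv) (X : Fin n → Fin T → EuclideanSpace ℝ (Fin d))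
    (hX : ∀ k t, ‖X k t‖ ≤ Rx) {l : ι → Fin n → ℝ} (hlB : ∀ i k, |l i k| ≤ B)
    (hl : ∀ i j k, |l i k - l j k| ≤
      |paramClassifier σ τ α (u i) (X k) - paramClassifier σ τ α (u j) (X k)|) :
    rad l ≤ Rv * (2 * κ * Real.exp (κ / 4) * ((RW * Rx + √m * |σ 0|) * (α * T)) * √n) := by
  set h : ι → Fin n → EuclideanSpace ℝ (Fin m) := fun i k =>
    hidden σ α (1 - α) (u i).1.1 (u i).1.2.1 T (X k)
  have hh : ∀ i k, ‖h i k‖ ≤ 2 * (α * T) * (RW * Rx + √m * |σ 0|) := fun i k =>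
    norm_hidden_le hσ hRW hRU hRx hα hα1 (u i).2.1 (u i).2.2.1 T hT _ (hX k)
  have hv : ∀ i k, |(inner ℝ (u i).1.2.2 (h i k) : ℝ)| ≤
      Rv * (2 * (α * T) * (RW * Rx + √m * |σ 0|)) := fun i k =>
    (abs_real_inner_le_norm _ _).trans (mul_le_mul (u i).2.2.2 (hh i k) (norm_nonneg _) hRv)
  -- Loss and `τ` are removed in a single contraction.
  have hrad : rad l ≤ rad fun i k => (inner ℝ (u i).1.2.2 (h i k) : ℝ) := by
    refine rad_le_rad (M := max B (Rv * (2 * (α * T) * (RW * Rx + √m * |σ 0|))))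
      (fun i k => (hv i k).trans (le_max_right _ _))
      (fun i k => (hlB i k).trans (le_max_left _ _)) fun i j k => (hl i j k).trans ?_
    simpa [Real.dist_eq, paramClassifier, classifier] using
      hτ.dist_le_mul (inner ℝ (u i).1.2.2 (h i k)) (inner ℝ (u j).1.2.2 (h j k))
  refine hrad.trans (le_trans ?_ (mul_le_mul_of_nonneg_left
    (signAvg_iSup_hidden_le hσ hκ hκσ hRW hRU hRx hα hα1 (fun i => (u i).2.1)
      (fun i => (u i).2.2.1) T hT X hX) hRv))
  rw [← signAvg_const_mul]
  refine signAvg_mono fun ε => ciSup_le fun i => ?_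
  rw [← inner_signSum]
  exact (real_inner_le_norm _ _).trans (mul_le_mul (u i).2.2.2
    (le_ciSup (bddAbove_norm_signSum hh ε) i) (norm_nonneg _) hRv)

end complexity

/-! ### Losses and the final bound. -/

theorem lipschitzOnWith_uncurry {L : ℝ → ℝ → ℝ} {s t : Set ℝ}
    (h1 : ∀ y ∈ s, LipschitzOnWith 1 (fun z => L y z) t)
    (h2 : ∀ z ∈ t, LipschitzOnWith 1 (fun y => L y z) s) :
    LipschitzOnWith 2 (fun q : ℝ × ℝ => L q.1 q.2) (s ×ˢ t) := by
  refine LipschitzOnWith.of_dist_le_mul ?_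
  rintro ⟨y, z⟩ ⟨hy, hz⟩ ⟨y', z'⟩ ⟨hy', hz'⟩
  have e1 := (h2 z hz).dist_le_mul y hy y' hy'
  have e2 := (h1 y' hy').dist_le_mul z hz z' hz'
  have e3 := dist_triangle (L y z) (L y' z) (L y' z')
  have e4 : dist y y' ≤ dist (y, z) (y', z') := le_max_left _ _
  have e5 : dist z z' ≤ dist (y, z) (y', z') := le_max_right _ _
  simp only [NNReal.coe_one, one_mul] at e1 e2
  simp only [NNReal.coe_ofNat]
  linarith

/-- The generalization bound for the class with parameters in `Param`. -/
theorem measure_exists_loss_gap_le {d m T n : ℕ} {σ τ : ℝ → ℝ} {RW RU Rx Rv α κ B δ : ℝ}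
    (hσ : LipschitzWith 1 σ) (hτ : LipschitzWith 1 τ) (hκ : 0 ≤ κ)
    (hκσ : IsLayerConst σ m κ) (hRW : 0 ≤ RW) (hRU : 0 ≤ RU) (hRx : 0 ≤ Rx) (hRv : 0 ≤ Rv)
    (hα : 0 ≤ α) (hα1 : α ≤ 1) (hT : α * (4 * T * RU) ≤ 1) (hn : 0 < n) (hδ : 0 < δ) (hδ1 : δ ≤ 1)
    {𝒴 𝒴hat : Set ℝ}
    (hf : ∀ (p : Param d m RW RU Rv) (X : Fin T → EuclideanSpace ℝ (Fin d)), (∀ t, ‖X t‖ ≤ Rx) →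
      paramClassifier σ τ α p X ∈ 𝒴hat) {L : ℝ → ℝ → ℝ}
    (hL1 : ∀ y ∈ 𝒴, LipschitzOnWith 1 (fun z => L y z) 𝒴hat)
    (hL2 : ∀ z ∈ 𝒴hat, LipschitzOnWith 1 (fun y => L y z) 𝒴)
    (hLB : ∀ y ∈ 𝒴, ∀ z ∈ 𝒴hat, 0 ≤ L y z ∧ L y z ≤ B)
    (P : Measure ((Fin T → EuclideanSpace ℝ (Fin d)) × ℝ)) [IsProbabilityMeasure P]
    (hP : ∀ᵐ p ∂P, (∀ t, ‖p.1 t‖ ≤ Rx) ∧ p.2 ∈ 𝒴) :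
    (Measure.pi fun _ : Fin n => P) {S | ∃ p : Param d m RW RU Rv,
      empiricalLoss S L (paramClassifier σ τ α p) + 2 * (Rv * (2 * κ * Real.exp (κ / 4) *
        ((RW * Rx + √m * |σ 0|) * (α * T)) * √n)) / n + B * √(Real.log (1 / δ) / n) <
      expectedLoss P L (paramClassifier σ τ α p)} ≤ ENNReal.ofReal δ := by
  have hne : Nonempty (Param d m RW RU Rv) := ⟨⟨(0, 0, 0), by simp [frobNorm, hRW, hRU, hRv]⟩⟩
  obtain ⟨p₀, hp₀⟩ := hP.exists
  have hB : 0 ≤ B := by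
    obtain ⟨h1, h2⟩ := hLB _ hp₀.2 _ (hf hne.some _ hp₀.1)
    exact h1.trans h2
  obtain ⟨Lt, hLt, hLeq⟩ := (lipschitzOnWith_uncurry hL1 hL2).extend_real
  set g : Param d m RW RU Rv → (Fin T → EuclideanSpace ℝ (Fin d)) × ℝ → ℝ := fun p ω =>
    max 0 (min B (Lt (ω.2, paramClassifier σ τ α p ω.1)))
  have hgL : ∀ p ω, (∀ t, ‖ω.1 t‖ ≤ Rx) ∧ ω.2 ∈ 𝒴 →
      g p ω = L ω.2 (paramClassifier σ τ α p ω.1) := fun p ω hω => by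
    have hz := hf p _ hω.1
    obtain ⟨h1, h2⟩ := hLB _ hω.2 _ hz
    have h3 : L ω.2 (paramClassifier σ τ α p ω.1) = Lt (ω.2, paramClassifier σ τ α p ω.1) :=
      hLeq (show (ω.2, paramClassifier σ τ α p ω.1) ∈ 𝒴 ×ˢ 𝒴hat from ⟨hω.2, hz⟩)
    simp only [g]
    rw [← h3, min_eq_right h2, max_eq_right h1]
  have hgX : ∀ p, Continuous (g p) := fun p => by
    have : Continuous fun ω : (Fin T → EuclideanSpace ℝ (Fin d)) × ℝ =>
        paramClassifier σ τ α p ω.1 :=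
      continuous_classifier hσ.continuous hτ.continuous α (1 - α) continuous_const
        continuous_const continuous_const continuous_fst
    exact continuous_const.max (continuous_const.min
      (hLt.continuous.comp (continuous_snd.prodMk this)))
  have hgp : ∀ ω, Continuous fun p => g p ω := fun ω => by
    have : Continuous fun p : Param d m RW RU Rv => paramClassifier σ τ α p ω.1 :=
      continuous_classifier hσ.continuous hτ.continuous α (1 - α)
        (continuous_fst.comp continuous_subtype_val)
        ((continuous_fst.comp continuous_snd).comp continuous_subtype_val)
        ((continuous_snd.comp continuous_snd).comp continuous_subtype_val) continuous_const
    exact continuous_const.max (continuous_const.min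
      (hLt.continuous.comp (continuous_const.prodMk this)))
  have hgood : ∀ᵐ S ∂(Measure.pi fun _ : Fin n => P),
      ∀ k, (∀ t, ‖(S k).1 t‖ ≤ Rx) ∧ (S k).2 ∈ 𝒴 := ae_all_iff.2 fun k =>
    (measurePreserving_eval (fun _ : Fin n => P) k).quasiMeasurePreserving.ae hP
  have hg0 : ∀ p ω, 0 ≤ g p ω := fun p ω => le_max_left _ _
  have hgB : ∀ p ω, g p ω ≤ B := fun p ω => max_le hB (min_le_left _ _)
  have hmain := measure_exists_gap_le_of_continuous P hn hB (fun p => (hgX p).measurable) hgp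
    hg0 hgB (r := Rv * (2 * κ * Real.exp (κ / 4) * ((RW * Rx + √m * |σ 0|) * (α * T)) * √n))
    (by positivity) (fun N u => by
      filter_upwards [hgood] with S hS
      refine rad_loss_le hσ hτ hκ hκσ hRW hRU hRx hRv hα hα1 hT u (fun k => (S k).1)
        (fun k => (hS k).1) (B := B)
        (fun i k => abs_le.2 ⟨by linarith [hg0 (u i) (S k)], hgB _ _⟩) fun i j k => ?_
      rw [hgL _ _ (hS k), hgL _ _ (hS k)]
      simpa [Real.dist_eq] using (hL1 _ (hS k).2).dist_le_mul _ (hf (u i) _ (hS k).1) _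
        (hf (u j) _ (hS k).1)) hδ hδ1
  refine le_trans (measure_mono_ae ?_) hmain
  filter_upwards [hgood] with S hS
  rintro ⟨p, hp⟩
  refine ⟨p, ?_⟩
  have e1 : expectedLoss P L (paramClassifier σ τ α p) = ∫ ω, g p ω ∂P :=
    integral_congr_ae (by filter_upwards [hP] with ω hω using (hgL p ω hω).symm)
  have e2 : empiricalLoss S L (paramClassifier σ τ α p) = (1 / n) * ∑ k, g p (S k) := by
    simp only [empiricalLoss, fun k => hgL p (S k) (hS k)]
  rw [← e1, ← e2]
  exact hp

end FastRNN

theorem theorem2 (σ : ℝ → ℝ) (hσ : LipschitzWith 1 σ) :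
    -- the constant of the `O(α T)`: a function of the hidden dimension alone,
    -- and not even of that when `σ'` has bounded variation
    ∃ c : ℕ → ℝ, (BoundedVariationOn (deriv σ) Set.univ → ∀ m m' : ℕ, c m = c m') ∧
      ∀ (d m T n : ℕ), 0 < n →
      ∀ (RW RU Rx Rv B δ α : ℝ), 0 < δ → δ ≤ 1 → 0 ≤ α → α ≤ 1 →
      ∀ τ : ℝ → ℝ, LipschitzWith 1 τ →
      ∀ 𝒴 𝒴hat : Set ℝ,
      -- all classifiers of the class take values in `𝒴hat` on admissible inputs
      (∀ (W : Matrix (Fin m) (Fin d) ℝ) (U : Matrix (Fin m) (Fin m) ℝ)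
        (v : EuclideanSpace ℝ (Fin m)) (X : Fin T → EuclideanSpace ℝ (Fin d)),
        FastRNN.frobNorm W ≤ RW → FastRNN.frobNorm U ≤ RU → ‖v‖ ≤ Rv → (∀ t, ‖X t‖ ≤ Rx) →
        FastRNN.classifier σ τ α (1 - α) W U v X ∈ 𝒴hat) →
      ∀ L : ℝ → ℝ → ℝ,
      (∀ y ∈ 𝒴, LipschitzOnWith 1 (fun z => L y z) 𝒴hat) →
      (∀ z ∈ 𝒴hat, LipschitzOnWith 1 (fun y => L y z) 𝒴) →
      (∀ y ∈ 𝒴, ∀ z ∈ 𝒴hat, 0 ≤ L y z ∧ L y z ≤ B) →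
      ∀ (P : Measure ((Fin T → EuclideanSpace ℝ (Fin d)) × ℝ)) [IsProbabilityMeasure P],
      (∀ᵐ p ∂P, (∀ t, ‖p.1 t‖ ≤ Rx) ∧ p.2 ∈ 𝒴) →
      -- for an i.i.d. sample of size `n`, the bound fails with probability at most `δ`
      (Measure.pi fun _ : Fin n => P)
        {S | ∀ (W : Matrix (Fin m) (Fin d) ℝ) (U : Matrix (Fin m) (Fin m) ℝ)
            (v : EuclideanSpace ℝ (Fin m)),
            FastRNN.frobNorm W ≤ RW → FastRNN.frobNorm U ≤ RU → ‖v‖ ≤ Rv →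
            FastRNN.AlphaCondition α T
              (FastRNN.jacobianSup σ α (1 - α) d m T RW RU Rx) RU U →
            FastRNN.expectedLoss P L (FastRNN.classifier σ τ α (1 - α) W U v) ≤
              FastRNN.empiricalLoss S L (FastRNN.classifier σ τ α (1 - α) W U v)
              + (RW * Rx + √(m : ℝ) * |σ 0|) * max 1 RU * Rv * (c m * (α * T)) / √(n : ℝ)
              + B * √(Real.log (1 / δ) / n)}ᶜ
        ≤ ENNReal.ofReal δ := by
  obtain ⟨κ, hκ, hκσ, hκbv⟩ := FastRNN.exists_isLayerConst hσ
  -- The factor 4 is the 2 of symmetrization times the 2κ of the hidden-state bound.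
  refine ⟨fun m => 4 * κ m * Real.exp (κ m / 4), fun h m m' => by simp only [hκbv h m m'], ?_⟩
  intro d m T n hn RW RU Rx Rv B δ α hδ hδ1 hα hα1 τ hτ 𝒴 𝒴hat hf L hL1 hL2 hLB P _ hP
  -- These conditions do not involve the particular weights; if one fails, no classifier is
  -- admissible and the failure event is empty.
  by_cases hpar : 0 ≤ RW ∧ 0 ≤ RU ∧ 0 ≤ Rv ∧ α * (4 * T * RU) ≤ 1
  swap
  · refine (measure_mono_null ?_ measure_empty).trans_le zero_le
    refine fun S hS => hS fun W U v hW hU hv hA => absurd ?_ hpar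
    exact ⟨(FastRNN.frobNorm_nonneg W).trans hW, (FastRNN.frobNorm_nonneg U).trans hU,
      (norm_nonneg v).trans hv, hA.2.1⟩
  obtain ⟨hRW, hRU, hRv, hT⟩ := hpar
  have hn' : (0 : ℝ) < n := Nat.cast_pos.2 hn
  -- a negative `Rx` is possible only for empty inputs, where the bound does not involve it
  obtain ⟨R, hR, hRX, hRT⟩ : ∃ R : ℝ, 0 ≤ R ∧
      (∀ X : Fin T → EuclideanSpace ℝ (Fin d), (∀ t, ‖X t‖ ≤ R) ↔ ∀ t, ‖X t‖ ≤ Rx) ∧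
      (RW * R + √m * |σ 0|) * (α * T) = (RW * Rx + √m * |σ 0|) * (α * T) := by
    rcases T.eq_zero_or_pos with rfl | hpos
    · exact ⟨0, le_rfl, fun X => ⟨fun _ t => t.elim0, fun _ t => t.elim0⟩, by simp⟩
    · obtain ⟨p, hp, -⟩ := hP.exists
      exact ⟨Rx, (norm_nonneg _).trans (hp ⟨0, hpos⟩), fun _ => Iff.rfl, rfl⟩
  have hmain := FastRNN.measure_exists_loss_gap_le hσ hτ (hκ m) (hκσ m) hRW hRU hR hRv hα hα1 hT
    hn hδ hδ1 (𝒴 := 𝒴) (𝒴hat := 𝒴hat) (fun p X hX => hf _ _ _ X p.2.1 p.2.2.1 p.2.2.2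
      ((hRX X).1 hX)) hL1 hL2 hLB P (hP.mono fun p hp => ⟨(hRX _).2 hp.1, hp.2⟩)
  refine (measure_mono fun S hS => ?_).trans hmain
  simp only [Set.mem_compl_iff, Set.mem_ofPred_eq, not_forall, not_le] at hS
  obtain ⟨W, U, v, hW, hU, hv, -, hS⟩ := hS
  refine ⟨⟨(W, U, v), hW, hU, hv⟩, lt_of_le_of_lt ?_ hS⟩
  rw [hRT]
  have hκm := hκ m
  have hD : 0 ≤ (RW * Rx + √m * |σ 0|) * (α * T) := hRT ▸ by positivity
  have h1 : 2 * (Rv * (2 * κ m * Real.exp (κ m / 4) *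
      ((RW * Rx + √m * |σ 0|) * (α * T)) * √n)) / n =
      ((RW * Rx + √m * |σ 0|) * (α * T)) * 1 * (Rv * (4 * κ m * Real.exp (κ m / 4))) / √n := by
    rw [div_eq_div_iff hn'.ne' (Real.sqrt_pos.2 hn').ne']
    calc _ = (RW * Rx + √m * |σ 0|) * (α * T) * Rv * (4 * κ m * Real.exp (κ m / 4)) *
          (√n * √n) := by ring
      _ = _ := by rw [Real.mul_self_sqrt hn'.le]; ring
  have h2 : ((RW * Rx + √m * |σ 0|) * (α * T)) * 1 * (Rv * (4 * κ m * Real.exp (κ m / 4))) / √n ≤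
      ((RW * Rx + √m * |σ 0|) * (α * T)) * max 1 RU *
        (Rv * (4 * κ m * Real.exp (κ m / 4))) / √n := by
    gcongr
    exact le_max_left _ _
  have h3 : ((RW * Rx + √m * |σ 0|) * (α * T)) * max 1 RU *
        (Rv * (4 * κ m * Real.exp (κ m / 4))) / √n = (RW * Rx + √m * |σ 0|) * max 1 RU * Rv *
        (4 * κ m * Real.exp (κ m / 4) * (α * T)) / √n := by ring
  have h4 := h1.trans_le (h2.trans h3.le)
  exact add_le_add_left (add_le_add_right h4 _) _
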